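/- Let $d\ge 1$, $M\ge 2$, and let $T_1,\dots,T_M$ be non-singular linear maps on $\mathbb{R}^d$ with operator norms $\|T_j\|<\tfrac12$ (with respect to the Euclidean norm) for $1\le j\le M$. For $\mathbf a=(a_1,\dots,a_M)\in\mathbb{R}^{Md}$ let $E^{\mathbf a}$ be the self-affine set with translations $\mathbf a$, that is, the unique non-empty compact set with $E^{\mathbf a}=\bigcup_{i=1}^M (T_i(E^{\mathbf a})+a_i)$. For a non-singular linear map $T$ with singular values $\alpha_1\ge\dots\ge\alpha_d>0$ put $\phi^0(T)=1$; $\phi^s(T)=\alpha_1\cdots\alpha_{m-1}\alpha_m^{\,s-m+1}$ if $0<s\le d$, where $m$ is the integer with $m-1<s\le m$; and $\phi^s(T)=(\alpha_1\cdots\alpha_d)^{s/d}$ if $s>d$. For a finite word $\mathbf u=u_1\cdots u_k$ over $\{1,\dots,M\}$ write $|\mathbf u|=k$, $T_{\mathbf u}=T_{u_1}\cdots T_{u_k}$, and let $\mathcal C_{\mathbf u}$ be the set of all infinite words in $\Sigma^\infty=\{1,\dots,M\}^{\mathbb N}$ that begin with $\mathbf u$. For $s\ge 0$ and $G\subseteq\Sigma^\infty$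 let $$\mathcal M^s(G)=\lim_{k\to\infty}\ \inf\Big\{\sum_{\mathbf u\in A}\phi^s(T_{\mathbf u}) : G\subseteq\bigcup_{\mathbf u\in A}\mathcal C_{\mathbf u},\ |\mathbf u|\ge k \text{ for all } \mathbf u\in A\Big\},$$ $$s_A=\inf\{s\ge 0:\mathcal M^s(\Sigma^\infty)=0\}.$$ Then $s_A$ is well defined and $s_A=\sup\{s\ge0:\mathcal M^s(\Sigma^\infty)=\infty\}$; moreover $s_A$ is equal to the affinity dimension of $(T_1,\dots,T_M)$, that is, it is the unique $s\ge 0$ with $$\lim_{k\to\infty}\Big(\sum_{|\mathbf u|=k}\phi^s(T_{\mathbf u})\Big)^{1/k}=1 .$$ For every $\mathbf a\in\mathbb{R}^{Md}$ the self-affine set $E^{\mathbf a}$ exists and is unique, and for $\mathcal L^{Md}$-almost every $\mathbf a\in\mathbb{R}^{Md}$: 1. $\dim_{\rm H}E^{\mathbf a}=s_A$ if $s_A\le d$; 2. $\mathcal L^d(E^{\mathbf a})>0$ if $s_A>d$. -/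

import Mathlib

open Set Filter Topology MeasureTheory
open scoped ENNReal

namespace SelfAffine

/-- `ℝ^d` with the Euclidean norm. -/
abbrev E (d : ℕ) : Type := EuclideanSpace ℝ (Fin d)

/-- `F` is an attractor of the self-affine iterated function system `Ψ_i(x) = T_i x + a_i`:
a non-empty compact set with `F = ⋃ i, Ψ_i(F)`. -/
def IsAttractor {d M : ℕ} (T : Fin M → (E d →L[ℝ] E d)) (a : Fin M → E d) (F : Set (E d)) :
    Prop :=
  F.Nonempty ∧ IsCompact F ∧ F = ⋃ i : Fin M, (fun x => T i x + a i) '' F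

/-- The `i`-th singular value of `T`, numbered from zero and listed in decreasing order: the
number usually written `α_{i+1}(T)`. -/
noncomputable def singVal {d : ℕ} (T : E d →L[ℝ] E d) (i : ℕ) : ℝ :=
  (T : E d →ₗ[ℝ] E d).singularValues i

/-- The singular value function `φ^s(T)`, for `s ≥ 0`:
`φ^0(T) = 1`; `φ^s(T) = α_1 ⋯ α_{m-1} α_m^{s-m+1}` for `0 < s ≤ d`, where `m = ⌈s⌉` is the integer
with `m - 1 < s ≤ m`; and `φ^s(T) = (α_1 ⋯ α_d)^{s/d}` for `s > d`. -/
noncomputable def svf {d : ℕ} (s : ℝ) (T : E d →L[ℝ] E d) : ℝ :=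
  if s ≤ 0 then 1
  else if s ≤ d then
    (∏ i ∈ Finset.range (⌈s⌉₊ - 1), singVal T i) * singVal T (⌈s⌉₊ - 1) ^ (s - (⌈s⌉₊ : ℝ) + 1)
  else (∏ i ∈ Finset.range d, singVal T i) ^ (s / (d : ℝ))

/-- `T_u = T_{u_1} T_{u_2} ⋯ T_{u_k}` for a finite word `u = u_1 u_2 ⋯ u_k`
(the identity for the empty word; multiplication is composition). -/
noncomputable def wordMap {d M : ℕ} (T : Fin M → (E d →L[ℝ] E d)) (u : List (Fin M)) :
    E d →L[ℝ] E d :=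
  (u.map T).prod

/-- The cylinder of the finite word `u`: all infinite words that begin with `u`. -/
def cylinder {M : ℕ} (u : List (Fin M)) : Set (ℕ → Fin M) :=
  {v | ∀ (i : ℕ) (hi : i < u.length), v i = u[i]}

/-- `𝓜^s_{(k)}(G)`: the infimum of `∑ φ^s(T_u)` over all covers of `G` by cylinders of words `u`
of length at least `k`. -/
noncomputable def netPremeasure {d M : ℕ} (T : Fin M → (E d →L[ℝ] E d)) (s : ℝ) (k : ℕ)
    (G : Set (ℕ → Fin M)) : ℝ≥0∞ :=
  ⨅ A ∈ {A : Set (List (Fin M)) | (∀ u ∈ A, k ≤ u.length) ∧ G ⊆ ⋃ u ∈ A, cylinder u},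
    ∑' u : A, ENNReal.ofReal (svf s (wordMap T u))

/-- The net measure `𝓜^s(G) = lim_{k → ∞} 𝓜^s_{(k)}(G)`; as `𝓜^s_{(k)}(G)` is nondecreasing in
`k`, the limit is the supremum. -/
noncomputable def netMeasure {d M : ℕ} (T : Fin M → (E d →L[ℝ] E d)) (s : ℝ)
    (G : Set (ℕ → Fin M)) : ℝ≥0∞ :=
  ⨆ k : ℕ, netPremeasure T s k G

/-- The critical value `s_A = inf {s ≥ 0 : 𝓜^s(Σ^∞) = 0}`. -/
noncomputable def sA {d M : ℕ} (T : Fin M → (E d →L[ℝ] E d)) : ℝ :=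
  sInf {s : ℝ | 0 ≤ s ∧ netMeasure T s univ = 0}

/-- `s` solves the equation `lim_{k → ∞} (∑_{|u| = k} φ^s(T_u))^{1/k} = 1` whose unique solution
`s ≥ 0` is the affinity dimension of `(T_1, …, T_M)`. -/
def IsAffinityDim {d M : ℕ} (T : Fin M → (E d →L[ℝ] E d)) (s : ℝ) : Prop :=
  0 ≤ s ∧
    Tendsto (fun k : ℕ => (∑ u : Fin k → Fin M, svf s (wordMap T (List.ofFn u))) ^ (1 / (k : ℝ)))
      atTop (𝓝 1)

end SelfAffine

/-! The attractor is the image of `Σ^∞` under the coding map `π_a(v) = ∑_k T_{v|k} a_{v_k}`, so its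
size is controlled by sums and measures on words.

Symbolic side. The product of the `m` largest singular values is the operator norm of `Λ^m T`, hence
submultiplicative. For `s ≤ d`, `φ^s` interpolates geometrically between two such products, and for
`s > d` it is a power of one, so it is submultiplicative too (`svf_mul_le`). By Fekete's lemma the
level sums have an exponential growth rate. Raising the exponent by `h` multiplies this rate by a
factor between `δ^h` and `2^{-h}`, where `δ > 0` bounds every `|det T_j|` from below; so the rate
decreases strictly and without jumps. A rate below 1 makes the net measure vanish. Conversely, a
finite cylinder cover of total weight at most 1 can be iterated and keeps the level sums bounded
(`growth_le_one_of_netMeasure_eq_zero`). Hence the rate at `s_A` is exactly 1.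

Upper bound, for every `a`. The set `T_u(ball)` is a flattened box; cutting it into pieces as wide
as a suitable singular value costs about `φ^t(T_u)` in `t`-dimensional Hausdorff measure, so level
sums tending to 0 bound the dimension.

Lower bound, for almost every `a`. For `s < s_A` there is a probability measure `μ` on words with
`μ(C_u) ≤ K φ^s(T_u)` (`exists_frostman_measure`). If `v` and `w` first differ at position `n`, then
`π_a(v) - π_a(w)` is `T_{v|n}` applied to a vector depending on `a`, and the norm bound 1/2 makes
its coefficient on some `a_i` boundedly invertible. Thus, for `t ≤ d`, the parameters `a` in a fixed
ball with `|π_a(v) - π_a(w)| ≤ r` have volume at most `C r^t / φ^t(T_{v|n})`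
(`exists_volume_coding_sub_le`). Integrating against `μ × μ` with `t < s` bounds the average number
of `r`-close pairs by `C r^t`. For `s_A ≤ d` this gives the image of `μ` finite energy at every
exponent below `s_A`; for `s_A > d` one may take `t = d`, and a Cauchy–Schwarz argument gives
positive volume. -/

namespace SelfAffine

/-! ### Singular values and the norm of exterior powers -/

section SingularValues

variable {d : ℕ}

theorem singVal_nonneg (T : E d →L[ℝ] E d) (i : ℕ) : 0 ≤ singVal T i :=
  LinearMap.singularValues_nonneg _ i

theorem singVal_antitone (T : E d →L[ℝ] E d) : Antitone (singVal T) :=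
  LinearMap.singularValues_antitone _

theorem prod_singVal (T : E d →L[ℝ] E d) : ∏ i ∈ Finset.range d, singVal T i = |T.det| := by
  have h := LinearMap.normDet_eq_prod_singularValues (T : E d →ₗ[ℝ] E d)
  rw [LinearMap.normDet_eq_abs_det] at h
  simpa [singVal] using h.symm

theorem singVal_pos {T : E d →L[ℝ] E d} (hT : T.det ≠ 0) {i : ℕ} (hi : i < d) :
    0 < singVal T i := by
  have h := prod_singVal T
  rcases (singVal_nonneg T i).lt_or_eq with h' | h'
  · exact h'
  · rw [Finset.prod_eq_zero (Finset.mem_range.2 hi) h'.symm] at h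
    exact absurd (abs_eq_zero.1 h.symm) hT

/-- An orthonormal basis of right singular vectors. -/
theorem exists_singular_basis (T : E d →L[ℝ] E d) :
    ∃ e : OrthonormalBasis (Fin d) ℝ (E d), ∀ (i : Fin d),
      LinearMap.adjoint (T : E d →ₗ[ℝ] E d) (T (e i)) = singVal T i ^ 2 • e i := by
  have hn : Module.finrank ℝ (E d) = d := by simp
  refine ⟨(T : E d →ₗ[ℝ] E d).isSymmetric_adjoint_comp_self.eigenvectorBasis hn, fun i => ?_⟩
  have h := (T : E d →ₗ[ℝ] E d).isSymmetric_adjoint_comp_self.apply_eigenvectorBasis hn i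
  rw [singVal, LinearMap.sq_singularValues_fin _ hn i]
  exact h

/-- `‖T x‖² = ∑ α_i² x_i²` in coordinates with respect to right singular vectors. -/
theorem norm_sq_apply_eq_sum {T : E d →L[ℝ] E d} {e : OrthonormalBasis (Fin d) ℝ (E d)}
    (he : ∀ i : Fin d,
      LinearMap.adjoint (T : E d →ₗ[ℝ] E d) (T (e i)) = singVal T i ^ 2 • e i) (x : E d) :
    ‖T x‖ ^ 2 = ∑ i : Fin d, singVal T i ^ 2 * (e.repr x i) ^ 2 := by
  have h1 : LinearMap.adjoint (T : E d →ₗ[ℝ] E d) (T x) =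
      ∑ i, e.repr x i • singVal T i ^ 2 • e i := by
    conv_lhs => rw [← e.sum_repr x]
    simp only [map_sum, map_smul, he]
  have h2 : ‖T x‖ ^ 2 = inner ℝ x (LinearMap.adjoint (T : E d →ₗ[ℝ] E d) (T x)) := by
    rw [LinearMap.adjoint_inner_right, ← real_inner_self_eq_norm_sq]; rfl
  rw [h2, h1, inner_sum]
  refine Finset.sum_congr rfl fun i _ => ?_
  rw [inner_smul_right, inner_smul_right, real_inner_comm, ← e.repr_apply_apply]
  ring

theorem singVal_le_norm (T : E d →L[ℝ] E d) (i : ℕ) : singVal T i ≤ ‖T‖ := by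
  by_cases hi : i < d
  · obtain ⟨e, he⟩ := exists_singular_basis T
    have h := norm_sq_apply_eq_sum he (e ⟨i, hi⟩)
    rw [Finset.sum_eq_single ⟨i, hi⟩] at h
    · have h3 : ‖T (e ⟨i, hi⟩)‖ ≤ ‖T‖ := by simpa using T.le_opNorm (e ⟨i, hi⟩)
      have h4 : ‖T (e ⟨i, hi⟩)‖ ^ 2 = singVal T i ^ 2 := by simpa using h
      rw [← (pow_left_inj₀ (norm_nonneg _) (singVal_nonneg T i) two_ne_zero).1 h4]
      exact h3
    · intro j _ hj
      simp [hj]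
    · simp
  · rw [singVal, LinearMap.singularValues_of_finrank_le _ (by simpa using hi)]
    exact norm_nonneg _

/-- The product of the `m` largest singular values. -/
noncomputable def topProd (m : ℕ) (T : E d →L[ℝ] E d) : ℝ :=
  ∏ i ∈ Finset.range m, singVal T i

theorem topProd_nonneg (m : ℕ) (T : E d →L[ℝ] E d) : 0 ≤ topProd m T :=
  Finset.prod_nonneg fun i _ => singVal_nonneg T i

/-- Used to compare an arbitrary product of `m` singular values, indices increasing, with the
product of the `m` largest. -/
theorem le_apply_of_orderEmbedding {m : ℕ} (f : Fin m ↪o Fin d) (i : Fin m) :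
    (i : ℕ) ≤ f i := by
  obtain ⟨i, hi⟩ := i
  induction i with
  | zero => exact Nat.zero_le _
  | succ k ih =>
    have h : f ⟨k, by omega⟩ < f ⟨k + 1, hi⟩ := f.strictMono (by simp)
    have := ih (by omega)
    simp only [Fin.lt_def] at h
    simp only at this ⊢
    omega

/-- Both sides are bilinear, so wedges of basis vectors suffice. There the inner product is a Gram
determinant, and the adjoint moves across entry by entry. -/
theorem inner_map_exteriorPower (m : ℕ) (T : E d →ₗ[ℝ] E d) (x y : ⋀[ℝ]^m (E d)) :
    inner ℝ (exteriorPower.map m T x) (exteriorPower.map m T y) =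
      inner ℝ x (exteriorPower.map m (LinearMap.adjoint T ∘ₗ T) y) := by
  let b := ((EuclideanSpace.basisFun (Fin d) ℝ).exteriorPower m).toBasis
  have key : (innerₗ _).compl₁₂ (exteriorPower.map m T) (exteriorPower.map m T) =
      (innerₗ (⋀[ℝ]^m (E d))).compl₁₂ LinearMap.id
        (exteriorPower.map m (LinearMap.adjoint T ∘ₗ T)) := by
    refine LinearMap.ext_basis b b fun i j => ?_
    simp only [b, OrthonormalBasis.toBasis_exteriorPower, exteriorPower.basis_apply,
      exteriorPower.ιMulti_family, LinearMap.compl₁₂_apply, innerₗ_apply_apply,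
      exteriorPower.map_apply_ιMulti, LinearMap.id_apply, exteriorPower.inner_ιMulti_ιMulti]
    congr 1
    ext a c
    simp [LinearMap.adjoint_inner_right]
  simpa using congrArg (fun f => f x y) key

/-- Each `e_i` is an eigenvector of `T* T`, so a wedge of them is an eigenvector of `Λ^m(T* T)`;
multilinearity pulls the eigenvalues out. -/
theorem map_exteriorPower_basis {T : E d →L[ℝ] E d} {e : OrthonormalBasis (Fin d) ℝ (E d)}
    (he : ∀ i : Fin d,
      LinearMap.adjoint (T : E d →ₗ[ℝ] E d) (T (e i)) = singVal T i ^ 2 • e i) (m : ℕ)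
    (s : Set.powersetCard (Fin d) m) :
    exteriorPower.map m (LinearMap.adjoint (T : E d →ₗ[ℝ] E d) ∘ₗ (T : E d →ₗ[ℝ] E d))
      (e.exteriorPower m s) =
      (∏ i, singVal T (Set.powersetCard.ofFinEmbEquiv.symm s i)) ^ 2 • e.exteriorPower m s := by
  have h1 : e.exteriorPower m s =
      exteriorPower.ιMulti ℝ m (e ∘ Set.powersetCard.ofFinEmbEquiv.symm s) := by
    rw [← OrthonormalBasis.coe_toBasis, OrthonormalBasis.toBasis_exteriorPower,
      exteriorPower.basis_apply]
    simp [exteriorPower.ιMulti_family]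
  rw [h1, exteriorPower.map_apply_ιMulti, ← Finset.prod_pow, ← AlternatingMap.map_smul_univ]
  congr 1
  ext1 i
  simp only [Function.comp, LinearMap.comp_apply, ContinuousLinearMap.coe_coe, he]

theorem norm_sq_map_exteriorPower {T : E d →L[ℝ] E d} {e : OrthonormalBasis (Fin d) ℝ (E d)}
    (he : ∀ i : Fin d,
      LinearMap.adjoint (T : E d →ₗ[ℝ] E d) (T (e i)) = singVal T i ^ 2 • e i) (m : ℕ)
    (x : ⋀[ℝ]^m (E d)) :
    ‖exteriorPower.map m (T : E d →ₗ[ℝ] E d) x‖ ^ 2 =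
      ∑ s : Set.powersetCard (Fin d) m, (∏ i, singVal T (Set.powersetCard.ofFinEmbEquiv.symm s i)) ^ 2 *
        ((e.exteriorPower m).repr x s) ^ 2 := by
  rw [← real_inner_self_eq_norm_sq, inner_map_exteriorPower]
  conv_lhs => rw [← (e.exteriorPower m).sum_repr x]
  rw [map_sum]
  simp only [map_smul, map_exteriorPower_basis he]
  rw [(e.exteriorPower m).sum_repr x, inner_sum]
  refine Finset.sum_congr rfl fun i _ => ?_
  have hs : ∀ (c : ℝ) (y : ⋀[ℝ]^m (E d)), inner ℝ x (c • y) = c * inner ℝ x y :=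
    fun c y => real_inner_smul_right x y c
  rw [hs, hs, real_inner_comm, ← (e.exteriorPower m).repr_apply_apply]
  ring

/-- Together with `exists_norm_map_exteriorPower_eq` this identifies `topProd m T` with the operator
norm of `Λ^m T`. -/
theorem norm_map_exteriorPower_le (m : ℕ) (T : E d →L[ℝ] E d) (x : ⋀[ℝ]^m (E d)) :
    ‖exteriorPower.map m (T : E d →ₗ[ℝ] E d) x‖ ≤ topProd m T * ‖x‖ := by
  obtain ⟨e, he⟩ := exists_singular_basis T
  refine le_of_sq_le_sq ?_ (mul_nonneg (topProd_nonneg m T) (norm_nonneg _))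
  rw [norm_sq_map_exteriorPower he, mul_pow, ← (e.exteriorPower m).repr.norm_map x,
    EuclideanSpace.norm_sq_eq, Finset.mul_sum]
  refine Finset.sum_le_sum fun s _ => ?_
  rw [Real.norm_eq_abs, sq_abs]
  refine mul_le_mul_of_nonneg_right (pow_le_pow_left₀
    (Finset.prod_nonneg fun i _ => singVal_nonneg T _) ?_ 2) (sq_nonneg _)
  rw [topProd, ← Fin.prod_univ_eq_prod_range]
  exact Finset.prod_le_prod (fun i _ => singVal_nonneg T _)
    fun i _ => singVal_antitone T (le_apply_of_orderEmbedding _ i)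

theorem exists_norm_map_exteriorPower_eq {m : ℕ} (hm : m ≤ d) (T : E d →L[ℝ] E d) :
    ∃ x : ⋀[ℝ]^m (E d), ‖x‖ = 1 ∧
      ‖exteriorPower.map m (T : E d →ₗ[ℝ] E d) x‖ = topProd m T := by
  obtain ⟨e, he⟩ := exists_singular_basis T
  -- The norm is attained at the wedge of the first `m` right singular vectors.
  let s := Set.powersetCard.ofFinEmbEquiv (Fin.castLEOrderEmb hm)
  refine ⟨e.exteriorPower m s, by simp, ?_⟩
  refine (pow_left_inj₀ (norm_nonneg _) (topProd_nonneg m T) two_ne_zero).1 ?_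
  rw [norm_sq_map_exteriorPower he, Finset.sum_eq_single s]
  · simp only [s, Equiv.symm_apply_apply, OrthonormalBasis.repr_self,
      PiLp.single_apply, if_true, one_pow, mul_one]
    rw [topProd, ← Fin.prod_univ_eq_prod_range]
    simp
  · intro t _ ht
    simp [ht]
  · simp

/-- Functoriality, `Λ^m(TU) = Λ^m T ∘ Λ^m U`, and submultiplicativity of the operator norm. -/
theorem topProd_mul_le {m : ℕ} (hm : m ≤ d) (T U : E d →L[ℝ] E d) :
    topProd m (T * U) ≤ topProd m T * topProd m U := by
  obtain ⟨x, hx, h⟩ := exists_norm_map_exteriorPower_eq hm (T * U)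
  rw [← h]
  have h2 : ((T * U : E d →L[ℝ] E d) : E d →ₗ[ℝ] E d) =
    (T : E d →ₗ[ℝ] E d) ∘ₗ (U : E d →ₗ[ℝ] E d) := rfl
  rw [h2, exteriorPower.map_comp, LinearMap.comp_apply]
  refine (norm_map_exteriorPower_le m T _).trans
    (mul_le_mul_of_nonneg_left ?_ (topProd_nonneg m T))
  simpa [hx] using norm_map_exteriorPower_le m U x

end SingularValues

/-! ### The singular value function -/

section SingularValueFunction

variable {d : ℕ}

/-- The exponent of the `i`-th singular value in `φ^s`. -/
noncomputable def svfExp (d : ℕ) (s : ℝ) (i : ℕ) : ℝ :=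
  if s ≤ d then max 0 (min 1 (s - i)) else s / d

theorem svfExp_nonneg {s : ℝ} (hs : 0 ≤ s) (i : ℕ) : 0 ≤ svfExp d s i := by
  unfold svfExp
  split_ifs
  · exact le_max_left _ _
  · positivity

theorem svfExp_le_one {s : ℝ} (hs : s ≤ d) (i : ℕ) : svfExp d s i ≤ 1 := by
  rw [svfExp, if_pos hs]
  exact max_le zero_le_one (min_le_left _ _)

theorem svfExp_zero (i : ℕ) : svfExp d 0 i = 0 := by
  rw [svfExp, if_pos (Nat.cast_nonneg d), max_eq_left]
  refine (min_le_right _ _).trans ?_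
  simp

theorem svfExp_mono {s t : ℝ} (hd : 1 ≤ d) (hst : s ≤ t) (i : ℕ) :
    svfExp d s i ≤ svfExp d t i := by
  have hd' : (0 : ℝ) < d := by exact_mod_cast hd
  unfold svfExp
  split_ifs with h1 h2 h2
  · exact max_le_max le_rfl (min_le_min le_rfl (by linarith))
  · have h3 : 1 ≤ t / d := by rw [le_div_iff₀ hd']; linarith
    exact (max_le zero_le_one (min_le_left _ _)).trans h3
  · exact absurd (hst.trans h2) h1
  · gcongr

/-- This lets a power `x^s` be spread over the singular values, so that bounds on `φ^s` can be
proved factor by factor. -/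
theorem sum_svfExp {s : ℝ} (hd : 1 ≤ d) (hs : 0 ≤ s) :
    ∑ i ∈ Finset.range d, svfExp d s i = s := by
  have hd' : (0 : ℝ) < d := by exact_mod_cast hd
  unfold svfExp
  split_ifs with h
  · have key : ∀ n : ℕ, ∑ i ∈ Finset.range n, max 0 (min 1 (s - i)) = min s n := by
      intro n
      induction n with
      | zero => simpa using hs
      | succ n ih =>
        rw [Finset.sum_range_succ, ih]
        push_cast
        rcases le_total s n with h1 | h1
        · rw [min_eq_left h1, min_eq_left (by linarith : s ≤ (n : ℝ) + 1), max_eq_left, add_zero]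
          exact (min_le_right _ _).trans (by linarith)
        · rw [min_eq_right h1, max_eq_right (le_min zero_le_one (by linarith))]
          rcases le_total s (n + 1) with h2 | h2
          · rw [min_eq_left h2, min_eq_right (by linarith)]; ring
          · rw [min_eq_right h2, min_eq_left (by linarith)]
    rw [key, min_eq_left h]
  · rw [Finset.sum_const, Finset.card_range, nsmul_eq_mul]
    field_simp

/-- One formula covers all the cases of the definition: for `s ≤ d` the exponents are 1, then one
fractional value, then 0. -/
theorem svf_eq_prod (T : E d →L[ℝ] E d) {s : ℝ} (hs : 0 ≤ s) :
    svf s T = ∏ i ∈ Finset.range d, singVal T i ^ svfExp d s i := by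
  rcases hs.eq_or_lt with rfl | hs
  · simp [svf, svfExp_zero]
  rw [svf, if_neg hs.not_ge]
  split_ifs with h
  · obtain ⟨k, hk⟩ : ∃ k, ⌈s⌉₊ = k + 1 := Nat.exists_eq_succ_of_ne_zero (Nat.ceil_pos.2 hs).ne'
    have h1 : s ≤ (k + 1 : ℕ) := hk ▸ Nat.le_ceil s
    have h2 : (k : ℝ) < s := Nat.lt_ceil.1 (by omega)
    have h3 : k + 1 ≤ d := by rw [← hk]; exact Nat.ceil_le.2 h
    push_cast at h1
    rw [hk]
    simp only [add_tsub_cancel_right]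
    rw [← Finset.prod_subset (Finset.range_mono h3), Finset.prod_range_succ]
    · congr 1
      · refine Finset.prod_congr rfl fun i hi => ?_
        have : (i : ℝ) + 1 ≤ k := by exact_mod_cast Finset.mem_range.1 hi
        rw [svfExp, if_pos h, min_eq_left (by linarith), max_eq_right zero_le_one, Real.rpow_one]
      · rw [svfExp, if_pos h, min_eq_right (by linarith), max_eq_right (by linarith)]
        congr 1
        push_cast; ring
    · intro i _ hi
      have : (k : ℝ) + 1 ≤ i := by exact_mod_cast not_lt.1 (fun h => hi (Finset.mem_range.2 h))
      rw [svfExp, if_pos h, max_eq_left, Real.rpow_zero]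
      exact (min_le_right _ _).trans (by linarith)
  · rw [← Real.finsetProd_rpow _ _ fun i _ => singVal_nonneg T i]
    refine Finset.prod_congr rfl fun i _ => ?_
    rw [svfExp, if_neg h]

theorem svf_zero (T : E d →L[ℝ] E d) : svf 0 T = 1 := by simp [svf]

theorem svf_nonneg (T : E d →L[ℝ] E d) {s : ℝ} (hs : 0 ≤ s) : 0 ≤ svf s T := by
  rw [svf_eq_prod T hs]
  exact Finset.prod_nonneg fun i _ => Real.rpow_nonneg (singVal_nonneg T i) _

theorem svf_pos {T : E d →L[ℝ] E d} (hT : T.det ≠ 0) {s : ℝ} (hs : 0 ≤ s) : 0 < svf s T := by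
  rw [svf_eq_prod T hs]
  exact Finset.prod_pos fun i hi => Real.rpow_pos_of_pos (singVal_pos hT (Finset.mem_range.1 hi)) _

theorem svf_mul_le (T U : E d →L[ℝ] E d) {s : ℝ} (hs : 0 ≤ s) :
    svf s (T * U) ≤ svf s T * svf s U := by
  rcases hs.eq_or_lt with rfl | hs
  · simp [svf_zero]
  by_cases h : s ≤ d
  · obtain ⟨k, hk⟩ : ∃ k, ⌈s⌉₊ = k + 1 := Nat.exists_eq_succ_of_ne_zero (Nat.ceil_pos.2 hs).ne'
    have h1 : s ≤ (k + 1 : ℕ) := hk ▸ Nat.le_ceil s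
    have h2 : (k : ℝ) < s := Nat.lt_ceil.1 (by omega)
    have h3 : k + 1 ≤ d := by rw [← hk]; exact Nat.ceil_le.2 h
    push_cast at h1
    -- For `k < s ≤ k + 1`, `φ^s` is a weighted geometric mean of `topProd k` and `topProd (k + 1)`,
    -- both of which are submultiplicative.
    have key : ∀ S : E d →L[ℝ] E d,
        svf s S = topProd k S ^ (k + 1 - s) * topProd (k + 1) S ^ (s - k) := by
      intro S
      rw [svf, if_neg hs.not_ge, if_pos h, hk]
      simp only [add_tsub_cancel_right]
      change topProd k S * _ = _
      rw [show topProd (k + 1) S = topProd k S * singVal S k from Finset.prod_range_succ _ _,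
        Real.mul_rpow (topProd_nonneg k S) (singVal_nonneg S k), ← mul_assoc,
        ← Real.rpow_add_of_nonneg (topProd_nonneg k S) (by linarith) (by linarith)]
      congr 1
      · rw [show (k : ℝ) + 1 - s + (s - k) = 1 by ring, Real.rpow_one]
      · congr 1; push_cast; ring
    rw [key, key, key]
    calc topProd k (T * U) ^ (k + 1 - s) * topProd (k + 1) (T * U) ^ (s - k)
        ≤ (topProd k T * topProd k U) ^ (k + 1 - s) *
          (topProd (k + 1) T * topProd (k + 1) U) ^ (s - k) := by
          refine mul_le_mul ?_ ?_ (Real.rpow_nonneg (topProd_nonneg _ _) _)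
            (Real.rpow_nonneg (mul_nonneg (topProd_nonneg _ _) (topProd_nonneg _ _)) _)
          · exact Real.rpow_le_rpow (topProd_nonneg _ _) (topProd_mul_le (by omega) T U)
              (by linarith)
          · exact Real.rpow_le_rpow (topProd_nonneg _ _) (topProd_mul_le h3 T U) (by linarith)
      _ = _ := by
          rw [Real.mul_rpow (topProd_nonneg _ _) (topProd_nonneg _ _),
            Real.mul_rpow (topProd_nonneg _ _) (topProd_nonneg _ _)]
          ring
  · simp only [svf, if_neg hs.not_ge, if_neg h]
    change topProd d (T * U) ^ (s / d) ≤ topProd d T ^ (s / d) * topProd d U ^ (s / d)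
    rw [← Real.mul_rpow (topProd_nonneg _ _) (topProd_nonneg _ _)]
    exact Real.rpow_le_rpow (topProd_nonneg _ _) (topProd_mul_le le_rfl T U) (by positivity)

/-- The remaining exponents are nonnegative with sum `t - s`. Bounding each factor by `‖T‖` above,
or by `|det T|` below when `‖T‖ ≤ 1`, gives the two comparisons that follow. -/
theorem svf_eq_mul_prod {T : E d →L[ℝ] E d} (hT : T.det ≠ 0) {s t : ℝ} (hs : 0 ≤ s)
    (hst : s ≤ t) : svf t T = svf s T *
      ∏ i ∈ Finset.range d, singVal T i ^ (svfExp d t i - svfExp d s i) := by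
  rw [svf_eq_prod T hs, svf_eq_prod T (hs.trans hst), ← Finset.prod_mul_distrib]
  refine Finset.prod_congr rfl fun i hi => ?_
  rw [← Real.rpow_add (singVal_pos hT (Finset.mem_range.1 hi))]
  congr 1; ring

theorem sum_svfExp_sub (hd : 1 ≤ d) {s t : ℝ} (hs : 0 ≤ s) (hst : s ≤ t) :
    ∑ i ∈ Finset.range d, (svfExp d t i - svfExp d s i) = t - s := by
  rw [Finset.sum_sub_distrib, sum_svfExp hd hs, sum_svfExp hd (hs.trans hst)]

theorem svf_le_svf_mul_norm_rpow (hd : 1 ≤ d) {T : E d →L[ℝ] E d} (hT : T.det ≠ 0) {s t : ℝ}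
    (hs : 0 ≤ s) (hst : s ≤ t) : svf t T ≤ svf s T * ‖T‖ ^ (t - s) := by
  have hpos : 0 < ‖T‖ := (singVal_pos hT (i := 0) (by omega)).trans_le (singVal_le_norm T 0)
  rw [svf_eq_mul_prod hT hs hst, ← sum_svfExp_sub hd hs hst, Real.rpow_sum_of_pos hpos]
  refine mul_le_mul_of_nonneg_left (Finset.prod_le_prod
    (fun i _ => Real.rpow_nonneg (singVal_nonneg T i) _) fun i _ => ?_) (svf_nonneg T hs)
  exact Real.rpow_le_rpow (singVal_nonneg T i) (singVal_le_norm T i)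
    (sub_nonneg.2 (svfExp_mono hd hst i))

theorem abs_det_le_singVal {T : E d →L[ℝ] E d} (hT : ‖T‖ ≤ 1) {i : ℕ} (hi : i < d) :
    |T.det| ≤ singVal T i := by
  rw [← prod_singVal, ← Finset.mul_prod_erase _ _ (Finset.mem_range.2 hi)]
  exact mul_le_of_le_one_right (singVal_nonneg T i) (Finset.prod_le_one
    (fun j _ => singVal_nonneg T j) fun j _ => (singVal_le_norm T j).trans hT)

theorem svf_mul_abs_det_rpow_le (hd : 1 ≤ d) {T : E d →L[ℝ] E d} (hT : T.det ≠ 0)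
    (hT1 : ‖T‖ ≤ 1) {s t : ℝ} (hs : 0 ≤ s) (hst : s ≤ t) :
    svf s T * |T.det| ^ (t - s) ≤ svf t T := by
  rw [svf_eq_mul_prod hT hs hst, ← sum_svfExp_sub hd hs hst,
    Real.rpow_sum_of_pos (abs_pos.2 hT)]
  refine mul_le_mul_of_nonneg_left (Finset.prod_le_prod
    (fun i _ => Real.rpow_nonneg (abs_nonneg _) _) fun i hi => ?_) (svf_nonneg T hs)
  exact Real.rpow_le_rpow (abs_nonneg _) (abs_det_le_singVal hT1 (Finset.mem_range.1 hi))
    (sub_nonneg.2 (svfExp_mono hd hst i))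

theorem svf_le_norm_rpow (hd : 1 ≤ d) {T : E d →L[ℝ] E d} (hT : T.det ≠ 0) {s : ℝ}
    (hs : 0 ≤ s) : svf s T ≤ ‖T‖ ^ s := by
  simpa [svf_zero] using svf_le_svf_mul_norm_rpow hd hT le_rfl hs

/-- Factorwise, `min 1 y ≤ y^e` for `0 ≤ e ≤ 1`. The condition `s ≤ d` keeps the exponents at most
1. -/
theorem prod_min_one_div_le (hd : 1 ≤ d) {T : E d →L[ℝ] E d} (hT : T.det ≠ 0) {s r : ℝ}
    (hs : 0 ≤ s) (hsd : s ≤ d) (hr : 0 < r) :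
    ∏ i ∈ Finset.range d, min 1 (r / singVal T i) ≤ r ^ s / svf s T := by
  have h1 : r ^ s = ∏ i ∈ Finset.range d, r ^ svfExp d s i := by
    rw [← Real.rpow_sum_of_pos hr, sum_svfExp hd hs]
  rw [svf_eq_prod T hs, h1, ← Finset.prod_div_distrib]
  refine Finset.prod_le_prod (fun i _ => le_min zero_le_one
    (div_nonneg hr.le (singVal_nonneg T i))) fun i hi => ?_
  have hp := singVal_pos hT (Finset.mem_range.1 hi)
  rw [← Real.div_rpow hr.le hp.le]
  have hq : 0 < r / singVal T i := div_pos hr hp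
  rcases le_total 1 (r / singVal T i) with h | h
  · rw [min_eq_left h]
    exact Real.one_le_rpow h (svfExp_nonneg hs i)
  · rw [min_eq_right h]
    conv_lhs => rw [← Real.rpow_one (r / singVal T i)]
    exact Real.rpow_le_rpow_of_exponent_ge hq h (svfExp_le_one hsd i)

end SingularValueFunction

/-! ### Products along words -/

section Words

variable {d M : ℕ} {T : Fin M → (E d →L[ℝ] E d)}

@[simp] theorem wordMap_nil : wordMap T [] = 1 := rfl

@[simp] theorem wordMap_cons (i : Fin M) (u : List (Fin M)) :
    wordMap T (i :: u) = T i * wordMap T u := by simp [wordMap]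

@[simp] theorem wordMap_append (u v : List (Fin M)) :
    wordMap T (u ++ v) = wordMap T u * wordMap T v := by simp [wordMap]

theorem det_mul (S U : E d →L[ℝ] E d) : (S * U).det = S.det * U.det :=
  LinearMap.det_comp _ _

theorem det_wordMap_ne_zero (hT : ∀ j, (T j).det ≠ 0) (u : List (Fin M)) :
    (wordMap T u).det ≠ 0 := by
  induction u with
  | nil => simp [ContinuousLinearMap.det]
  | cons i u ih => rw [wordMap_cons, det_mul]; exact mul_ne_zero (hT i) ih

theorem pow_le_abs_det_wordMap {δ : ℝ} (hδ : 0 ≤ δ) (h : ∀ j, δ ≤ |(T j).det|)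
    (u : List (Fin M)) : δ ^ u.length ≤ |(wordMap T u).det| := by
  induction u with
  | nil => simp [ContinuousLinearMap.det]
  | cons i u ih =>
    rw [wordMap_cons, det_mul, abs_mul, List.length_cons, pow_succ']
    exact mul_le_mul (h i) ih (pow_nonneg hδ _) (abs_nonneg _)

theorem norm_wordMap_le {c : ℝ} (hc : 0 ≤ c) (h : ∀ j, ‖T j‖ ≤ c) (u : List (Fin M)) :
    ‖wordMap T u‖ ≤ c ^ u.length := by
  induction u with
  | nil => rw [wordMap_nil, List.length_nil, pow_zero]; exact ContinuousLinearMap.norm_id_le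
  | cons i u ih =>
    rw [wordMap_cons, List.length_cons, pow_succ']
    exact (norm_mul_le _ _).trans (mul_le_mul (h i) ih (norm_nonneg _) hc)

end Words

/-! ### Level sums and their growth rate -/

section LevelSums

variable {d M : ℕ} {T : Fin M → (E d →L[ℝ] E d)}

theorem exists_pos_le_abs_det (hM : 1 ≤ M) (hT : ∀ j, (T j).det ≠ 0) :
    ∃ δ : ℝ, 0 < δ ∧ δ ≤ 1 ∧ ∀ j, δ ≤ |(T j).det| := by
  have : Nonempty (Fin M) := ⟨⟨0, hM⟩⟩
  obtain ⟨j, hj⟩ := Finite.exists_min fun j => |(T j).det|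
  exact ⟨min 1 |(T j).det|, lt_min one_pos (abs_pos.2 (hT j)), min_le_left _ _,
    fun i => (min_le_right _ _).trans (hj i)⟩

theorem norm_wordMap_le_half_pow (hn : ∀ j, ‖T j‖ < 1 / 2) (u : List (Fin M)) :
    ‖wordMap T u‖ ≤ (1 / 2 : ℝ) ^ u.length :=
  norm_wordMap_le (by norm_num) (fun j => (hn j).le) u

theorem norm_wordMap_le_one (hn : ∀ j, ‖T j‖ < 1 / 2) (u : List (Fin M)) :
    ‖wordMap T u‖ ≤ 1 :=
  (norm_wordMap_le_half_pow hn u).trans (pow_le_one₀ (by norm_num) (by norm_num))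

theorem svf_wordMap_le (hd : 1 ≤ d) (hT : ∀ j, (T j).det ≠ 0) (hn : ∀ j, ‖T j‖ < 1 / 2)
    {s t : ℝ} (hs : 0 ≤ s) (hst : s ≤ t) (u : List (Fin M)) :
    svf t (wordMap T u) ≤ svf s (wordMap T u) * ((1 / 2 : ℝ) ^ (t - s)) ^ u.length := by
  refine (svf_le_svf_mul_norm_rpow hd (det_wordMap_ne_zero hT u) hs hst).trans
    (mul_le_mul_of_nonneg_left ?_ (svf_nonneg _ hs))
  rw [Real.rpow_pow_comm (by norm_num)]
  exact Real.rpow_le_rpow (norm_nonneg _) (norm_wordMap_le_half_pow hn u) (sub_nonneg.2 hst)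

theorem le_svf_wordMap (hd : 1 ≤ d) (hT : ∀ j, (T j).det ≠ 0) (hn : ∀ j, ‖T j‖ < 1 / 2)
    {δ : ℝ} (hδ : 0 < δ) (hδT : ∀ j, δ ≤ |(T j).det|)
    {s t : ℝ} (hs : 0 ≤ s) (hst : s ≤ t) (u : List (Fin M)) :
    svf s (wordMap T u) * (δ ^ (t - s)) ^ u.length ≤ svf t (wordMap T u) := by
  refine le_trans (mul_le_mul_of_nonneg_left ?_ (svf_nonneg _ hs)) (svf_mul_abs_det_rpow_le hd
    (det_wordMap_ne_zero hT u) (norm_wordMap_le_one hn u) hs hst)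
  rw [Real.rpow_pow_comm hδ.le]
  exact Real.rpow_le_rpow (pow_nonneg hδ.le _) (pow_le_abs_det_wordMap hδ.le hδT u)
    (sub_nonneg.2 hst)

theorem pow_le_svf_wordMap (hd : 1 ≤ d) (hT : ∀ j, (T j).det ≠ 0) (hn : ∀ j, ‖T j‖ < 1 / 2)
    {δ : ℝ} (hδ : 0 < δ) (hδT : ∀ j, δ ≤ |(T j).det|) {s : ℝ} (hs : 0 ≤ s)
    (u : List (Fin M)) : (δ ^ s) ^ u.length ≤ svf s (wordMap T u) := by
  simpa [svf_zero] using le_svf_wordMap hd hT hn hδ hδT le_rfl hs u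

theorem svf_wordMap_le_pow (hd : 1 ≤ d) (hT : ∀ j, (T j).det ≠ 0) (hn : ∀ j, ‖T j‖ < 1 / 2)
    {s : ℝ} (hs : 0 ≤ s) (u : List (Fin M)) :
    svf s (wordMap T u) ≤ ((1 / 2 : ℝ) ^ s) ^ u.length := by
  simpa [svf_zero] using svf_wordMap_le hd hT hn le_rfl hs u

/-- `∑_{|u| = k} φ^s(T_u)`. -/
noncomputable def levelSum (T : Fin M → (E d →L[ℝ] E d)) (s : ℝ) (k : ℕ) : ℝ :=
  ∑ u : Fin k → Fin M, svf s (wordMap T (List.ofFn u))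

theorem levelSum_nonneg {s : ℝ} (hs : 0 ≤ s) (k : ℕ) : 0 ≤ levelSum T s k :=
  Finset.sum_nonneg fun _ _ => svf_nonneg _ hs

theorem levelSum_pos (hM : 1 ≤ M) (hT : ∀ j, (T j).det ≠ 0) {s : ℝ} (hs : 0 ≤ s) (k : ℕ) :
    0 < levelSum T s k :=
  Finset.sum_pos (fun _ _ => svf_pos (det_wordMap_ne_zero hT _) hs) ⟨fun _ => ⟨0, hM⟩, by simp⟩

theorem levelSum_zero (k : ℕ) : levelSum T 0 k = (M : ℝ) ^ k := by
  simp [levelSum, svf_zero]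

theorem sum_append (f : List (Fin M) → ℝ) (j k : ℕ) :
    ∑ u : Fin (j + k) → Fin M, f (List.ofFn u) =
      ∑ v : Fin j → Fin M, ∑ w : Fin k → Fin M, f (List.ofFn v ++ List.ofFn w) := by
  rw [← Fintype.sum_prod_type', ← (Fin.appendEquiv j k).sum_comp]
  refine Finset.sum_congr rfl fun p _ => ?_
  rw [← List.ofFn_fin_append]
  rfl

theorem levelSum_add_le {s : ℝ} (hs : 0 ≤ s) (j k : ℕ) :
    levelSum T s (j + k) ≤ levelSum T s j * levelSum T s k := by
  rw [levelSum, sum_append (fun u => svf s (wordMap T u)), levelSum, levelSum,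
    Finset.sum_mul_sum]
  refine Finset.sum_le_sum fun v _ => Finset.sum_le_sum fun w _ => ?_
  rw [wordMap_append]
  exact svf_mul_le _ _ hs

theorem levelSum_le_mul (hd : 1 ≤ d) (hT : ∀ j, (T j).det ≠ 0) (hn : ∀ j, ‖T j‖ < 1 / 2)
    {s t : ℝ} (hs : 0 ≤ s) (hst : s ≤ t) (k : ℕ) :
    levelSum T t k ≤ levelSum T s k * ((1 / 2 : ℝ) ^ (t - s)) ^ k := by
  rw [levelSum, levelSum, Finset.sum_mul]
  exact Finset.sum_le_sum fun u _ => by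
    simpa using svf_wordMap_le hd hT hn hs hst (List.ofFn u)

theorem mul_le_levelSum (hd : 1 ≤ d) (hT : ∀ j, (T j).det ≠ 0) (hn : ∀ j, ‖T j‖ < 1 / 2)
    {δ : ℝ} (hδ : 0 < δ) (hδT : ∀ j, δ ≤ |(T j).det|)
    {s t : ℝ} (hs : 0 ≤ s) (hst : s ≤ t) (k : ℕ) :
    levelSum T s k * (δ ^ (t - s)) ^ k ≤ levelSum T t k := by
  rw [levelSum, levelSum, Finset.sum_mul]
  exact Finset.sum_le_sum fun u _ => by
    simpa using le_svf_wordMap hd hT hn hδ hδT hs hst (List.ofFn u)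

/-- The growth rate `lim_k (∑_{|u| = k} φ^s(T_u))^{1/k}`. -/
noncomputable def growth (T : Fin M → (E d →L[ℝ] E d)) (s : ℝ) : ℝ :=
  limUnder atTop fun k : ℕ => levelSum T s k ^ (1 / (k : ℝ))

/-- Fekete's lemma for the subadditive sequence `log (levelSum T s k)`; the determinant bound keeps
its quotients by `k` bounded below. -/
theorem tendsto_growth (hd : 1 ≤ d) (hM : 1 ≤ M) (hT : ∀ j, (T j).det ≠ 0)
    (hn : ∀ j, ‖T j‖ < 1 / 2) {s : ℝ} (hs : 0 ≤ s) :
    Tendsto (fun k : ℕ => levelSum T s k ^ (1 / (k : ℝ))) atTop (𝓝 (growth T s)) := by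
  refine tendsto_nhds_limUnder ?_
  obtain ⟨δ, hδ, -, hδT⟩ := exists_pos_le_abs_det hM hT
  have hsub : Subadditive fun k => Real.log (levelSum T s k) := fun j k => by
    rw [← Real.log_mul (levelSum_pos hM hT hs j).ne' (levelSum_pos hM hT hs k).ne']
    exact Real.log_le_log (levelSum_pos hM hT hs _) (levelSum_add_le hs j k)
  have hδs : 0 < δ ^ s := Real.rpow_pos_of_pos hδ s
  have hbdd : BddBelow (range fun k : ℕ => Real.log (levelSum T s k) / k) := by
    -- The 0 accounts for `k = 0`, where division by zero gives 0.
    refine ⟨min 0 (Real.log (δ ^ s)), ?_⟩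
    rintro _ ⟨k, rfl⟩
    rcases k.eq_zero_or_pos with rfl | hk
    · simp
    refine (min_le_right _ _).trans ?_
    have hk' : (0 : ℝ) < k := by exact_mod_cast hk
    simp only
    rw [le_div_iff₀ hk', mul_comm, ← Real.log_pow]
    refine Real.log_le_log (pow_pos hδs k) ?_
    have h := mul_le_levelSum hd hT hn hδ hδT le_rfl hs k
    rw [levelSum_zero, sub_zero] at h
    refine le_trans ?_ h
    exact le_mul_of_one_le_left (pow_pos hδs k).le (one_le_pow₀ (by exact_mod_cast hM))
  refine ⟨Real.exp hsub.lim, ((Real.continuous_exp.tendsto _).comp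
    (hsub.tendsto_lim hbdd)).congr fun k => ?_⟩
  simp only [Function.comp]
  rw [Real.rpow_def_of_pos (levelSum_pos hM hT hs k), mul_one_div]

theorem growth_nonneg (hd : 1 ≤ d) (hM : 1 ≤ M) (hT : ∀ j, (T j).det ≠ 0)
    (hn : ∀ j, ‖T j‖ < 1 / 2) {s : ℝ} (hs : 0 ≤ s) : 0 ≤ growth T s :=
  ge_of_tendsto' (tendsto_growth hd hM hT hn hs) fun k =>
    Real.rpow_nonneg (levelSum_nonneg hs k) _

theorem mul_pow_rpow_one_div {x y : ℝ} (hx : 0 ≤ x) (hy : 0 ≤ y) {k : ℕ} (hk : k ≠ 0) :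
    (x * y ^ k) ^ (1 / (k : ℝ)) = x ^ (1 / (k : ℝ)) * y := by
  rw [Real.mul_rpow hx (pow_nonneg hy k), one_div, Real.pow_rpow_inv_natCast hy hk]

theorem growth_le_mul (hd : 1 ≤ d) (hM : 1 ≤ M) (hT : ∀ j, (T j).det ≠ 0)
    (hn : ∀ j, ‖T j‖ < 1 / 2) {s t : ℝ} (hs : 0 ≤ s) (hst : s ≤ t) :
    growth T t ≤ growth T s * (1 / 2 : ℝ) ^ (t - s) := by
  refine le_of_tendsto_of_tendsto (tendsto_growth hd hM hT hn (hs.trans hst))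
    ((tendsto_growth hd hM hT hn hs).mul_const _) ?_
  filter_upwards [eventually_ne_atTop 0] with k hk
  rw [← mul_pow_rpow_one_div (levelSum_nonneg hs k) (by positivity) hk]
  exact Real.rpow_le_rpow (levelSum_nonneg (hs.trans hst) k)
    (levelSum_le_mul hd hT hn hs hst k) (by positivity)

/-- With `growth_le_mul` this pins the rate from both sides as the exponent varies; here it serves
as a substitute for continuity. -/
theorem mul_le_growth (hd : 1 ≤ d) (hM : 1 ≤ M) (hT : ∀ j, (T j).det ≠ 0)
    (hn : ∀ j, ‖T j‖ < 1 / 2) {δ : ℝ} (hδ : 0 < δ) (hδT : ∀ j, δ ≤ |(T j).det|)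
    {s t : ℝ} (hs : 0 ≤ s) (hst : s ≤ t) :
    growth T s * δ ^ (t - s) ≤ growth T t := by
  refine le_of_tendsto_of_tendsto ((tendsto_growth hd hM hT hn hs).mul_const _)
    (tendsto_growth hd hM hT hn (hs.trans hst)) ?_
  filter_upwards [eventually_ne_atTop 0] with k hk
  have h0 : 0 ≤ δ ^ (t - s) := Real.rpow_nonneg hδ.le _
  rw [← mul_pow_rpow_one_div (levelSum_nonneg hs k) h0 hk]
  exact Real.rpow_le_rpow (mul_nonneg (levelSum_nonneg hs k) (pow_nonneg h0 k))
    (mul_le_levelSum hd hT hn hδ hδT hs hst k) (by positivity)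

theorem growth_zero (hd : 1 ≤ d) (hM : 1 ≤ M) (hT : ∀ j, (T j).det ≠ 0)
    (hn : ∀ j, ‖T j‖ < 1 / 2) : growth T 0 = M := by
  refine tendsto_nhds_unique (tendsto_growth hd hM hT hn le_rfl) ?_
  refine tendsto_const_nhds.congr' ?_
  filter_upwards [eventually_ne_atTop 0] with k hk
  rw [levelSum_zero, one_div, Real.pow_rpow_inv_natCast (Nat.cast_nonneg M) hk]

theorem growth_strictAnti (hd : 1 ≤ d) (hM : 1 ≤ M) (hT : ∀ j, (T j).det ≠ 0)
    (hn : ∀ j, ‖T j‖ < 1 / 2) {s t : ℝ} (hs : 0 ≤ s) (hst : s < t) :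
    growth T t < growth T s := by
  obtain ⟨δ, hδ, -, hδT⟩ := exists_pos_le_abs_det hM hT
  have h1 := mul_le_growth hd hM hT hn hδ hδT le_rfl hs
  rw [growth_zero hd hM hT hn] at h1
  have h2 : 0 < growth T s := lt_of_lt_of_le
    (mul_pos (by exact_mod_cast hM) (Real.rpow_pos_of_pos hδ _)) h1
  refine (growth_le_mul hd hM hT hn hs hst.le).trans_lt (mul_lt_of_lt_one_right h2 ?_)
  exact Real.rpow_lt_one (by norm_num) (by norm_num) (sub_pos.2 hst)

theorem tendsto_levelSum_zero (hd : 1 ≤ d) (hM : 1 ≤ M) (hT : ∀ j, (T j).det ≠ 0)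
    (hn : ∀ j, ‖T j‖ < 1 / 2) {s : ℝ} (hs : 0 ≤ s) (h : growth T s < 1) :
    Tendsto (levelSum T s) atTop (𝓝 0) := by
  obtain ⟨q, hq, hq1⟩ := exists_between h
  have hq0 : 0 ≤ q := (growth_nonneg hd hM hT hn hs).trans hq.le
  refine squeeze_zero' (Eventually.of_forall fun k => levelSum_nonneg hs k) ?_
    (tendsto_pow_atTop_nhds_zero_of_lt_one hq0 hq1)
  filter_upwards [(tendsto_growth hd hM hT hn hs).eventually_lt_const hq,
    eventually_ne_atTop 0] with k hk hk0
  rw [← Real.rpow_inv_natCast_pow (levelSum_nonneg hs k) hk0, ← one_div]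
  exact pow_le_pow_left₀ (Real.rpow_nonneg (levelSum_nonneg hs k) _) hk.le k

end LevelSums

/-! ### Net measures against level sums -/

section NetMeasure

variable {d M : ℕ} {T : Fin M → (E d →L[ℝ] E d)}

theorem isClopen_cylinder (u : List (Fin M)) : IsClopen (cylinder u) := by
  have h : cylinder u = ⋂ i : Fin u.length, (fun v : ℕ → Fin M => v i) ⁻¹' {u[i]} := by
    ext v
    simp [cylinder, Fin.forall_iff]
  rw [h]
  exact isClopen_iInter_of_finite fun i =>
    (isClopen_discrete _).preimage (continuous_apply _)

theorem netPremeasure_mono_length (T : Fin M → (E d →L[ℝ] E d)) (s : ℝ)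
    (G : Set (ℕ → Fin M)) : Monotone fun k => netPremeasure T s k G := by
  intro j k hjk
  refine le_iInf₂ fun A hA => iInf₂_le A ⟨fun u hu => hjk.trans (hA.1 u hu), hA.2⟩

theorem mem_cylinder_ofFn (v : ℕ → Fin M) (k : ℕ) :
    v ∈ cylinder (List.ofFn fun i : Fin k => v i) := by
  intro i hi
  simp

theorem netPremeasure_le_levelSum {s : ℝ} (hs : 0 ≤ s) {k n : ℕ} (hkn : k ≤ n)
    (G : Set (ℕ → Fin M)) : netPremeasure T s k G ≤ ENNReal.ofReal (levelSum T s n) := by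
  have hA : (∀ u ∈ range (List.ofFn : (Fin n → Fin M) → List (Fin M)), k ≤ u.length) ∧
      G ⊆ ⋃ u ∈ range (List.ofFn : (Fin n → Fin M) → List (Fin M)), cylinder u := by
    refine ⟨?_, fun v _ => mem_iUnion₂.2
      ⟨_, ⟨fun i : Fin n => v i, rfl⟩, mem_cylinder_ofFn v n⟩⟩
    rintro _ ⟨u, rfl⟩
    simpa using hkn
  refine le_trans (iInf₂_le (range (List.ofFn : (Fin n → Fin M) → List (Fin M))) hA) ?_
  rw [tsum_range (fun u => ENNReal.ofReal (svf s (wordMap T u))) List.ofFn_injective,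
    tsum_fintype, levelSum, ENNReal.ofReal_sum_of_nonneg fun _ _ => svf_nonneg _ hs]

theorem netMeasure_eq_zero_of_growth_lt_one (hd : 1 ≤ d) (hM : 1 ≤ M)
    (hT : ∀ j, (T j).det ≠ 0) (hn : ∀ j, ‖T j‖ < 1 / 2) {s : ℝ} (hs : 0 ≤ s)
    (h : growth T s < 1) : netMeasure T s univ = 0 := by
  refine le_antisymm (iSup_le fun k => ?_) bot_le
  have h1 : Tendsto (fun n => ENNReal.ofReal (levelSum T s n)) atTop (𝓝 0) := by
    simpa using ENNReal.tendsto_ofReal (tendsto_levelSum_zero hd hM hT hn hs h)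
  refine ge_of_tendsto h1 ?_
  filter_upwards [eventually_ge_atTop k] with n hkn
  exact netPremeasure_le_levelSum hs hkn univ

/-- Only the words `u ++ w` contribute, and each contributes at most `φ^s(T_u) φ^s(T_w)`. -/
theorem sum_prefix_le {s : ℝ} (hs : 0 ≤ s) (u : List (Fin M)) (k : ℕ) :
    ∑ w : Fin (u.length + k) → Fin M,
      (if (List.ofFn w).take u.length = u then svf s (wordMap T (List.ofFn w)) else 0) ≤
      svf s (wordMap T u) * levelSum T s k := by
  rw [sum_append (fun w => if w.take u.length = u then svf s (wordMap T w) else 0),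
    Finset.sum_eq_single (fun i => u[i])]
  · rw [levelSum, Finset.mul_sum]
    refine Finset.sum_le_sum fun w _ => ?_
    have h : List.ofFn (fun i : Fin u.length => u[i]) = u := List.ofFn_getElem
    rw [h, if_pos (by simp), wordMap_append]
    exact svf_mul_le _ _ hs
  · intro v _ hv
    refine Finset.sum_eq_zero fun w _ => if_neg fun h => hv ?_
    rw [List.take_left' (by simp)] at h
    funext i
    simp only [Fin.getElem_fin]
    have h' : ∀ (x : List (Fin M)) (hx : i < x.length), x = u → x[i] = u[i] := by
      rintro x hx rfl
      rfl
    simpa using (h' _ (by simp) h)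
  · simp

/-- A finite cover of total weight at most 1 gives a renewal inequality for the level sums. They
therefore stay bounded, and `k`-th roots of a constant tend to 1. -/
theorem growth_le_one_of_netMeasure_eq_zero (hd : 1 ≤ d) (hM : 1 ≤ M)
    (hT : ∀ j, (T j).det ≠ 0) (hn : ∀ j, ‖T j‖ < 1 / 2) {s : ℝ} (hs : 0 ≤ s)
    (h : netMeasure T s univ = 0) : growth T s ≤ 1 := by
  have h1 : netPremeasure T s 1 univ < 1 := by
    refine lt_of_le_of_lt ?_ one_pos
    rw [← h]
    exact le_iSup (fun k => netPremeasure T s k univ) 1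
  simp only [netPremeasure, iInf_lt_iff] at h1
  obtain ⟨A, ⟨hA1, hA2⟩, hA⟩ := h1
  rw [biUnion_eq_iUnion] at hA2
  obtain ⟨t, ht⟩ := isCompact_univ.elim_finite_subcover (fun u : A => cylinder (u : List (Fin M)))
    (fun u => (isClopen_cylinder _).isOpen) hA2
  have hsum : ∑ u ∈ t, svf s (wordMap T (u : List (Fin M))) ≤ 1 := by
    have h2 := (ENNReal.sum_le_tsum t).trans hA.le
    rw [← ENNReal.ofReal_sum_of_nonneg fun _ _ => svf_nonneg _ hs] at h2
    simpa using h2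
  obtain ⟨K, hK⟩ : ∃ K : ℕ, ∀ u ∈ t, (u : List (Fin M)).length ≤ K :=
    ⟨t.sup fun u => (u : List (Fin M)).length, fun u hu =>
      Finset.le_sup (f := fun u : A => (u : List (Fin M)).length) hu⟩
  have hrec : ∀ n, K ≤ n → levelSum T s n ≤
      ∑ u ∈ t, svf s (wordMap T (u : List (Fin M))) *
        levelSum T s (n - (u : List (Fin M)).length) := by
    intro n hKn
    calc levelSum T s n
        ≤ ∑ w : Fin n → Fin M, ∑ u ∈ t,
          (if (List.ofFn w).take (u : List (Fin M)).length = u then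
            svf s (wordMap T (List.ofFn w)) else 0) := by
          refine Finset.sum_le_sum fun w _ => ?_
          -- The padding letter is arbitrary: since `n ≥ K`, the covering word lies inside `w`.
          obtain ⟨u, hu, hwu⟩ := mem_iUnion₂.1
            (ht (mem_univ fun i => if h : i < n then w ⟨i, h⟩ else ⟨0, hM⟩))
          refine le_trans ?_ (Finset.single_le_sum (fun u _ => ?_) hu)
          · rw [if_pos]
            refine List.ext_getElem (by simpa using (hK u hu).trans hKn) fun i h1 h2 => ?_
            have h3 := hwu i h2
            have h4 : i < n := h2.trans_le ((hK u hu).trans hKn)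
            simp only [h4, dif_pos] at h3
            simp [h3]
          · split_ifs
            · exact svf_nonneg _ hs
            · exact le_rfl
      _ = ∑ u ∈ t, ∑ w : Fin n → Fin M,
          (if (List.ofFn w).take (u : List (Fin M)).length = u then
            svf s (wordMap T (List.ofFn w)) else 0) := Finset.sum_comm
      _ ≤ _ := by
          refine Finset.sum_le_sum fun u hu => ?_
          obtain ⟨k, rfl⟩ := Nat.exists_eq_add_of_le ((hK u hu).trans hKn)
          rw [add_tsub_cancel_left]
          exact sum_prefix_le hs _ _
  set B := ∑ j ∈ Finset.range (K + 1), levelSum T s j with hB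
  have hBpos : 0 < B := Finset.sum_pos (fun j _ => levelSum_pos hM hT hs j) ⟨0, by simp⟩
  have hbound : ∀ n, levelSum T s n ≤ B := by
    intro n
    induction n using Nat.strong_induction_on with
    | _ n ih =>
      rcases le_or_gt n K with hnK | hnK
      · exact Finset.single_le_sum (f := levelSum T s) (fun j _ => levelSum_nonneg hs j)
          (Finset.mem_range.2 (by omega))
      · refine (hrec n hnK.le).trans ?_
        calc _ ≤ ∑ u ∈ t, svf s (wordMap T (u : List (Fin M))) * B := by
              refine Finset.sum_le_sum fun u hu => mul_le_mul_of_nonneg_left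
                (ih _ ?_) (svf_nonneg _ hs)
              have := hA1 u u.2
              omega
          _ ≤ B := by
              rw [← Finset.sum_mul]
              exact mul_le_of_le_one_left hBpos.le hsum
  have hlim : Tendsto (fun k : ℕ => B ^ (1 / (k : ℝ))) atTop (𝓝 1) := by
    have := (tendsto_const_nhds (x := B)).rpow (tendsto_one_div_atTop_nhds_zero_nat (𝕜 := ℝ))
      (Or.inl hBpos.ne')
    simpa using this
  exact le_of_tendsto_of_tendsto' (tendsto_growth hd hM hT hn hs) hlim fun k =>
    Real.rpow_le_rpow (levelSum_nonneg hs k) (hbound k) (by positivity)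

/-- In an admissible cover every word has length at least `k`, so passing from `s` to `t` gains the
factor `2^{-(t-s)}` at least `k` times. -/
theorem netPremeasure_le_mul (hd : 1 ≤ d) (hT : ∀ j, (T j).det ≠ 0)
    (hn : ∀ j, ‖T j‖ < 1 / 2) {s t : ℝ} (hs : 0 ≤ s) (hst : s ≤ t) (k : ℕ)
    (G : Set (ℕ → Fin M)) : netPremeasure T t k G ≤
      ENNReal.ofReal ((1 / 2 : ℝ) ^ (t - s)) ^ k * netPremeasure T s k G := by
  set q : ℝ := (1 / 2 : ℝ) ^ (t - s) with hq
  have hq0 : 0 < q := by positivity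
  have hq1 : q ≤ 1 := Real.rpow_le_one (by norm_num) (by norm_num) (sub_nonneg.2 hst)
  have h0 : ENNReal.ofReal q ^ k ≠ 0 := pow_ne_zero _ (by simpa using hq0)
  have h1 : ENNReal.ofReal q ^ k ≠ ∞ := ENNReal.pow_ne_top ENNReal.ofReal_ne_top
  rw [netPremeasure, netPremeasure, ENNReal.mul_iInf_of_ne h0 h1]
  refine iInf_mono fun A => ?_
  rw [ENNReal.mul_iInf_of_ne h0 h1]
  refine iInf_mono fun hA => ?_
  rw [← ENNReal.tsum_mul_left]
  refine ENNReal.tsum_le_tsum fun u => ?_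
  rw [← ENNReal.ofReal_pow hq0.le, ← ENNReal.ofReal_mul (pow_nonneg hq0.le _), mul_comm]
  refine ENNReal.ofReal_le_ofReal ((svf_wordMap_le hd hT hn hs hst u).trans
    (mul_le_mul_of_nonneg_left ?_ (svf_nonneg _ hs)))
  exact pow_le_pow_of_le_one hq0.le hq1 (hA.1 u u.2)

theorem netMeasure_eq_zero_of_ne_top (hd : 1 ≤ d) (hT : ∀ j, (T j).det ≠ 0)
    (hn : ∀ j, ‖T j‖ < 1 / 2) {s t : ℝ} (hs : 0 ≤ s) (hst : s < t) {G : Set (ℕ → Fin M)}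
    (h : netMeasure T s G ≠ ∞) : netMeasure T t G = 0 := by
  refine le_antisymm (iSup_le fun k => ?_) bot_le
  have h1 : Tendsto (fun n => ENNReal.ofReal ((1 / 2 : ℝ) ^ (t - s)) ^ n * netMeasure T s G)
      atTop (𝓝 0) := by
    have h2 : ENNReal.ofReal ((1 / 2 : ℝ) ^ (t - s)) < 1 := by
      rw [← ENNReal.ofReal_one, ENNReal.ofReal_lt_ofReal_iff one_pos]
      exact Real.rpow_lt_one (by norm_num) (by norm_num) (sub_pos.2 hst)
    have h3 := ENNReal.Tendsto.mul_const (ENNReal.tendsto_pow_atTop_nhds_zero_of_lt_one h2)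
      (Or.inr h)
    simpa using h3
  refine ge_of_tendsto h1 ?_
  filter_upwards [eventually_ge_atTop k] with n hkn
  calc netPremeasure T t k G ≤ netPremeasure T t n G := netPremeasure_mono_length T t G hkn
    _ ≤ _ := netPremeasure_le_mul hd hT hn hs hst.le n G
    _ ≤ _ := mul_le_mul_right (le_iSup (fun k => netPremeasure T s k G) n) _

end NetMeasure

/-! ### The critical value and the affinity dimension -/

section CriticalValue

variable {d M : ℕ} {T : Fin M → (E d →L[ℝ] E d)}

theorem isGLB_sA (hd : 1 ≤ d) (hM : 1 ≤ M) (hT : ∀ j, (T j).det ≠ 0)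
    (hn : ∀ j, ‖T j‖ < 1 / 2) : IsGLB {s : ℝ | 0 ≤ s ∧ netMeasure T s univ = 0} (sA T) := by
  refine isGLB_csInf ?_ ⟨0, fun s hs => hs.1⟩
  -- At exponent `k` the growth rate is at most `M 2^{-k} < 1`, so the set defining `sA` is
  -- nonempty.
  obtain ⟨k, hk⟩ := exists_pow_lt_of_lt_one (x := 1 / (M : ℝ)) (y := 1 / 2)
    (by have : (0 : ℝ) < M := by exact_mod_cast hM
        positivity) (by norm_num)
  have hM' : (0 : ℝ) < M := by exact_mod_cast hM
  refine ⟨k, Nat.cast_nonneg k, netMeasure_eq_zero_of_growth_lt_one hd hM hT hn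
    (Nat.cast_nonneg k) ?_⟩
  refine (growth_le_mul hd hM hT hn le_rfl (Nat.cast_nonneg k)).trans_lt ?_
  rw [growth_zero hd hM hT hn, sub_zero, Real.rpow_natCast]
  rw [lt_div_iff₀ hM'] at hk
  linarith

theorem netMeasure_eq_zero_of_sA_lt (hd : 1 ≤ d) (hM : 1 ≤ M) (hT : ∀ j, (T j).det ≠ 0)
    (hn : ∀ j, ‖T j‖ < 1 / 2) {t : ℝ} (ht : sA T < t) : netMeasure T t univ = 0 := by
  obtain ⟨s, ⟨hs, hs0⟩, hst⟩ := (isGLB_lt_iff (isGLB_sA hd hM hT hn)).1 ht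
  exact netMeasure_eq_zero_of_ne_top hd hT hn hs hst (by simp [hs0])

theorem netMeasure_ne_zero_of_lt_sA (hd : 1 ≤ d) (hM : 1 ≤ M) (hT : ∀ j, (T j).det ≠ 0)
    (hn : ∀ j, ‖T j‖ < 1 / 2) {t : ℝ} (ht0 : 0 ≤ t) (ht : t < sA T) :
    netMeasure T t univ ≠ 0 := fun h =>
  ht.not_ge ((isGLB_sA hd hM hT hn).1 ⟨ht0, h⟩)

theorem sA_nonneg (hd : 1 ≤ d) (hM : 1 ≤ M) (hT : ∀ j, (T j).det ≠ 0)
    (hn : ∀ j, ‖T j‖ < 1 / 2) : 0 ≤ sA T :=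
  (isGLB_sA hd hM hT hn).2 fun _ hs => hs.1

/-- Above `s_A` the net measure vanishes, so the rate is at most 1; letting `t` decrease to `s_A`
gives one inequality. Were the rate below 1 at `s_A`, it would be below 1 slightly to the left,
where the net measure is nonzero. -/
theorem growth_sA (hd : 1 ≤ d) (hM : 2 ≤ M) (hT : ∀ j, (T j).det ≠ 0)
    (hn : ∀ j, ‖T j‖ < 1 / 2) : growth T (sA T) = 1 := by
  have hM1 : 1 ≤ M := by omega
  have hs0 := sA_nonneg hd hM1 hT hn
  obtain ⟨δ, hδ, -, hδT⟩ := exists_pos_le_abs_det hM1 hT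
  have hcont : ∀ x : ℝ, Tendsto (fun t : ℝ => δ ^ (t - x)) (𝓝 x) (𝓝 1) := fun x => by
    have h : ContinuousAt (fun t : ℝ => δ ^ (t - x)) x :=
      ContinuousAt.rpow continuousAt_const (by fun_prop) (Or.inl hδ.ne')
    simpa [ContinuousAt] using h
  have hle : growth T (sA T) ≤ 1 := by
    have h1 : Tendsto (fun t : ℝ => growth T (sA T) * δ ^ (t - sA T)) (𝓝[>] (sA T))
        (𝓝 (growth T (sA T))) := by
      simpa using ((hcont (sA T)).const_mul (growth T (sA T))).mono_left nhdsWithin_le_nhds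
    refine le_of_tendsto h1 ?_
    filter_upwards [self_mem_nhdsWithin] with t ht
    exact (mul_le_growth hd hM1 hT hn hδ hδT hs0 (le_of_lt ht)).trans
      (growth_le_one_of_netMeasure_eq_zero hd hM1 hT hn (hs0.trans (le_of_lt ht))
        (netMeasure_eq_zero_of_sA_lt hd hM1 hT hn ht))
  refine le_antisymm hle (le_of_not_gt fun hlt => ?_)
  have hpos : 0 < sA T := by
    refine hs0.lt_of_ne fun h => ?_
    rw [← h, growth_zero hd hM1 hT hn] at hlt
    have : (2 : ℝ) ≤ M := by exact_mod_cast hM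
    linarith
  have h1 : Tendsto (fun t : ℝ => δ ^ (sA T - t)) (𝓝[<] (sA T)) (𝓝 1) := by
    have h2 := (hcont (sA T)).inv₀ one_ne_zero
    simp only [inv_one] at h2
    refine (h2.mono_left nhdsWithin_le_nhds).congr fun t => ?_
    rw [← Real.rpow_neg hδ.le, neg_sub]
  have h3 : ∀ᶠ t in 𝓝[<] (sA T), 0 < t :=
    (eventually_gt_nhds hpos).filter_mono nhdsWithin_le_nhds
  obtain ⟨t, ⟨ht1, ht2⟩, ht3⟩ := ((h1.eventually_const_lt hlt).and h3 |>.and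
    self_mem_nhdsWithin).exists
  have h4 := mul_le_growth hd hM1 hT hn hδ hδT ht2.le (le_of_lt ht3)
  refine netMeasure_ne_zero_of_lt_sA hd hM1 hT hn ht2.le ht3
    (netMeasure_eq_zero_of_growth_lt_one hd hM1 hT hn ht2.le ?_)
  by_contra hge
  have h5 : δ ^ (sA T - t) ≤ growth T t * δ ^ (sA T - t) :=
    le_mul_of_one_le_left (Real.rpow_nonneg hδ.le _) (not_lt.1 hge)
  linarith

theorem sA_pos (hd : 1 ≤ d) (hM : 2 ≤ M) (hT : ∀ j, (T j).det ≠ 0)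
    (hn : ∀ j, ‖T j‖ < 1 / 2) : 0 < sA T := by
  have hM1 : 1 ≤ M := by omega
  refine (sA_nonneg hd hM1 hT hn).lt_of_ne fun h => ?_
  have h1 := growth_sA hd hM hT hn
  rw [← h, growth_zero hd hM1 hT hn] at h1
  have : (2 : ℝ) ≤ M := by exact_mod_cast hM
  linarith

theorem isLUB_sA (hd : 1 ≤ d) (hM : 2 ≤ M) (hT : ∀ j, (T j).det ≠ 0)
    (hn : ∀ j, ‖T j‖ < 1 / 2) : IsLUB {s : ℝ | 0 ≤ s ∧ netMeasure T s univ = ∞} (sA T) := by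
  have hM1 : 1 ≤ M := by omega
  refine ⟨fun s hs => le_of_not_gt fun h => ?_, fun b hb => le_of_not_gt fun h => ?_⟩
  · have := hs.2
    rw [netMeasure_eq_zero_of_sA_lt hd hM1 hT hn h] at this
    exact ENNReal.zero_ne_top this
  -- If the net measure at `t` were finite, it would vanish at a larger `t'` still below `s_A`. The
  -- maximum with 0 keeps `t` nonnegative.
  · obtain ⟨t, ht1, ht2⟩ := exists_between (max_lt h (sA_pos hd hM hT hn))
    obtain ⟨t', ht3, ht4⟩ := exists_between ht2
    have ht0 : 0 ≤ t := (le_max_right b 0).trans ht1.le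
    have hmem : t ∈ {s : ℝ | 0 ≤ s ∧ netMeasure T s univ = ∞} := by
      refine ⟨ht0, ?_⟩
      by_contra hne
      exact netMeasure_ne_zero_of_lt_sA hd hM1 hT hn (ht0.trans ht3.le) ht4
        (netMeasure_eq_zero_of_ne_top hd hT hn ht0 ht3 hne)
    exact (hb hmem).not_gt ((le_max_left b 0).trans_lt ht1)

theorem isAffinityDim_iff (hd : 1 ≤ d) (hM : 2 ≤ M) (hT : ∀ j, (T j).det ≠ 0)
    (hn : ∀ j, ‖T j‖ < 1 / 2) (s : ℝ) : IsAffinityDim T s ↔ s = sA T := by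
  have hM1 : 1 ≤ M := by omega
  have hs0 := sA_nonneg hd hM1 hT hn
  have h1 := growth_sA hd hM hT hn
  constructor
  · rintro ⟨hs, hlim⟩
    have h2 : growth T s = 1 := tendsto_nhds_unique (tendsto_growth hd hM1 hT hn hs) hlim
    rcases lt_trichotomy s (sA T) with h | h | h
    · have := growth_strictAnti hd hM1 hT hn hs h
      linarith
    · exact h
    · have := growth_strictAnti hd hM1 hT hn hs0 h
      linarith
  · rintro rfl
    exact ⟨hs0, h1 ▸ tendsto_growth hd hM1 hT hn hs0⟩

end CriticalValue

/-! ### The coding map and the attractor -/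

section Coding

variable {d M : ℕ} {T : Fin M → (E d →L[ℝ] E d)}

/-- The word formed by the first `k` letters of `v`. -/
def initWord (v : ℕ → Fin M) (k : ℕ) : List (Fin M) := List.ofFn fun i : Fin k => v i

@[simp] theorem length_initWord (v : ℕ → Fin M) (k : ℕ) : (initWord v k).length = k := by
  simp [initWord]

@[simp] theorem initWord_zero (v : ℕ → Fin M) : initWord v 0 = [] := by simp [initWord]

theorem initWord_succ (v : ℕ → Fin M) (k : ℕ) :
    initWord v (k + 1) = v 0 :: initWord (fun n => v (n + 1)) k := by
  simp [initWord, List.ofFn_succ]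

theorem mem_cylinder_initWord_iff {v w : ℕ → Fin M} {k : ℕ} :
    w ∈ cylinder (initWord v k) ↔ ∀ i < k, w i = v i := by
  simp [cylinder, initWord]

/-- The coding map `π_a(v) = ∑_k T_{v|k} a_{v_k}`. -/
noncomputable def coding (T : Fin M → (E d →L[ℝ] E d)) (a : Fin M → E d) (v : ℕ → Fin M) :
    E d :=
  ∑' k, wordMap T (initWord v k) (a (v k))

theorem norm_coding_term_le (hn : ∀ j, ‖T j‖ < 1 / 2) (a : Fin M → E d) (v : ℕ → Fin M)
    (k : ℕ) : ‖wordMap T (initWord v k) (a (v k))‖ ≤ (1 / 2 : ℝ) ^ k * ‖a‖ := by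
  refine (ContinuousLinearMap.le_opNorm _ _).trans (mul_le_mul ?_ (norm_le_pi_norm a _)
    (norm_nonneg _) (by positivity))
  simpa using norm_wordMap_le_half_pow hn (initWord v k)

theorem summable_half_pow_mul (x : ℝ) : Summable fun k : ℕ => (1 / 2 : ℝ) ^ k * x :=
  (summable_geometric_of_lt_one (by norm_num) (by norm_num)).mul_right x

theorem summable_coding (hn : ∀ j, ‖T j‖ < 1 / 2) (a : Fin M → E d) (v : ℕ → Fin M) :
    Summable fun k => wordMap T (initWord v k) (a (v k)) :=
  Summable.of_norm_bounded (summable_half_pow_mul ‖a‖) (norm_coding_term_le hn a v)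

theorem norm_coding_le (hn : ∀ j, ‖T j‖ < 1 / 2) (a : Fin M → E d) (v : ℕ → Fin M) :
    ‖coding T a v‖ ≤ 2 * ‖a‖ := by
  have h := tsum_of_norm_bounded (summable_half_pow_mul ‖a‖).hasSum (norm_coding_term_le hn a v)
  rwa [tsum_mul_right, tsum_geometric_of_lt_one (by norm_num) (by norm_num),
    show (1 - 1 / 2 : ℝ)⁻¹ = 2 by norm_num] at h

theorem coding_eq (hn : ∀ j, ‖T j‖ < 1 / 2) (a : Fin M → E d) (v : ℕ → Fin M) :
    coding T a v = T (v 0) (coding T a fun n => v (n + 1)) + a (v 0) := by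
  rw [coding, (summable_coding hn a v).tsum_eq_zero_add, coding,
    ContinuousLinearMap.map_tsum _ (summable_coding hn a _), add_comm]
  simp [initWord_succ]

theorem coding_sub_coding (hn : ∀ j, ‖T j‖ < 1 / 2) (a : Fin M → E d) {v w : ℕ → Fin M}
    (k : ℕ) (h : ∀ i < k, v i = w i) :
    coding T a v - coding T a w = wordMap T (initWord v k)
      (coding T a (fun n => v (n + k)) - coding T a fun n => w (n + k)) := by
  induction k generalizing v w with
  | zero => simp
  | succ k ih =>
    rw [coding_eq hn a v, coding_eq hn a w, ← h 0 (by omega), add_sub_add_right_eq_sub, ← map_sub,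
      ih fun i hi => h (i + 1) (by omega), initWord_succ, wordMap_cons]
    simp [add_assoc]

theorem continuous_wordMap_initWord (T : Fin M → (E d →L[ℝ] E d)) (k : ℕ) :
    Continuous fun v : ℕ → Fin M => wordMap T (initWord v k) := by
  have h : Continuous fun u : Fin k → Fin M => wordMap T (List.ofFn u) :=
    continuous_of_discreteTopology
  exact h.comp (continuous_pi fun i => continuous_apply _)

/-- The series converges uniformly when `a` stays in a bounded set. Continuity in the pair is what
makes the later uses of Tonelli measurable. -/
theorem continuous_coding (hn : ∀ j, ‖T j‖ < 1 / 2) :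
    Continuous fun p : (Fin M → E d) × (ℕ → Fin M) => coding T p.1 p.2 := by
  rw [continuous_iff_continuousAt]
  intro p
  have h : ContinuousOn (fun p : (Fin M → E d) × (ℕ → Fin M) => coding T p.1 p.2)
      (Metric.ball 0 (‖p.1‖ + 1) ×ˢ univ) := by
    refine continuousOn_tsum (fun k => Continuous.continuousOn ?_)
      (summable_half_pow_mul (‖p.1‖ + 1)) fun k q hq => ?_
    · refine ((continuous_wordMap_initWord T k).comp continuous_snd).clm_apply ?_
      have h2 : Continuous fun q : (Fin M → E d) × Fin M => q.1 q.2 :=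
        continuous_prod_of_discrete_right.2 fun i => continuous_apply i
      exact h2.comp (continuous_fst.prodMk ((continuous_apply k).comp continuous_snd))
    · refine (norm_coding_term_le hn q.1 q.2 k).trans ?_
      have := (mem_ball_zero_iff.1 hq.1).le
      gcongr
  refine h.continuousAt ((Metric.isOpen_ball.prod isOpen_univ).mem_nhds ⟨?_, mem_univ _⟩)
  rw [mem_ball_zero_iff]
  linarith

theorem continuous_coding_right (hn : ∀ j, ‖T j‖ < 1 / 2) (a : Fin M → E d) :
    Continuous (coding T a) :=
  (continuous_coding hn).comp (continuous_const.prodMk continuous_id)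

theorem isAttractor_range_coding (hM : 1 ≤ M) (hn : ∀ j, ‖T j‖ < 1 / 2) (a : Fin M → E d) :
    IsAttractor T a (range (coding T a)) := by
  refine ⟨⟨_, fun _ => ⟨0, hM⟩, rfl⟩, isCompact_range (continuous_coding_right hn a), ?_⟩
  ext x
  simp only [mem_range, mem_iUnion, mem_image, exists_exists_eq_and]
  constructor
  · rintro ⟨v, rfl⟩
    exact ⟨v 0, fun n => v (n + 1), (coding_eq hn a v).symm⟩
  · rintro ⟨i, v, rfl⟩
    exact ⟨fun n => Nat.casesOn n i v, coding_eq hn a _⟩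

/-- Take a point of `F` farthest from `G`. It is `T_i y + a_i` with `y ∈ F`, so its distance to `G`
is at most half that of `y`, hence at most half the maximum; the maximum is 0. -/
theorem IsAttractor.subset (hn : ∀ j, ‖T j‖ < 1 / 2) {a : Fin M → E d} {F G : Set (E d)}
    (hF : IsAttractor T a F) (hG : IsAttractor T a G) : F ⊆ G := by
  obtain ⟨x, hx, hmax⟩ := hF.2.1.exists_isMaxOn hF.1 (Metric.continuous_infDist_pt G).continuousOn
  have hx' := hx
  rw [hF.2.2] at hx'
  obtain ⟨i, y, hy, rfl⟩ := mem_iUnion.1 hx'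
  obtain ⟨z, hz, hyz⟩ := hG.2.1.exists_infDist_eq_dist hG.1 y
  have h1 : T i z + a i ∈ G := by
    rw [hG.2.2]
    exact mem_iUnion.2 ⟨i, z, hz, rfl⟩
  have h2 : Metric.infDist (T i y + a i) G ≤ 1 / 2 * Metric.infDist y G := by
    refine (Metric.infDist_le_dist_of_mem h1).trans ?_
    rw [hyz, dist_add_right, dist_eq_norm, dist_eq_norm, ← map_sub]
    exact ((T i).le_opNorm _).trans (mul_le_mul_of_nonneg_right (hn i).le (norm_nonneg _))
  have h3 : Metric.infDist y G ≤ Metric.infDist (T i y + a i) G := hmax hy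
  have h4 : 0 ≤ Metric.infDist y G := Metric.infDist_nonneg
  intro w hw
  have h5 : Metric.infDist w G ≤ Metric.infDist (T i y + a i) G := hmax hw
  have h6 : 0 ≤ Metric.infDist w G := Metric.infDist_nonneg
  exact (hG.2.1.isClosed.mem_iff_infDist_zero hG.1).2 (by linarith)

theorem IsAttractor.eq_range_coding (hM : 1 ≤ M) (hn : ∀ j, ‖T j‖ < 1 / 2) {a : Fin M → E d}
    {F : Set (E d)} (hF : IsAttractor T a F) : F = range (coding T a) :=
  (hF.subset hn (isAttractor_range_coding hM hn a)).antisymm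
    ((isAttractor_range_coding hM hn a).subset hn hF)

end Coding

/-! ### Upper bound for the Hausdorff dimension -/

section UpperBound

variable {d M : ℕ} {T : Fin M → (E d →L[ℝ] E d)}

theorem abs_repr_le_norm (e : OrthonormalBasis (Fin d) ℝ (E d)) (x : E d) (i : Fin d) :
    |e.repr x i| ≤ ‖x‖ := by
  rw [← e.repr.norm_map x, ← Real.norm_eq_abs]
  exact PiLp.norm_apply_le _ i

/-- The image of a ball under `T` is covered by boxes of diameter at most `d α_{k+1}`, where
`k < t ≤ k + 1`, in a number comparable with `φ^t(T) / α_{k+1}^t`. -/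
theorem exists_cover_image_closedBall {t R : ℝ} (ht : 0 < t) (htd : t ≤ d) (hR : 0 ≤ R) :
    ∃ C : ℝ, 0 ≤ C ∧ ∀ T : E d →L[ℝ] E d, T.det ≠ 0 →
      ∃ (ι : Type) (_ : Fintype ι) (B : ι → Set (E d)) (ρ : ℝ), 0 ≤ ρ ∧ ρ ≤ d * ‖T‖ ∧
        (T '' Metric.closedBall 0 R ⊆ ⋃ i, B i) ∧
        (∀ i, ∀ x ∈ B i, ∀ y ∈ B i, dist x y ≤ ρ) ∧
        Fintype.card ι * ρ ^ t ≤ C * svf t T := by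
  obtain ⟨k, hk⟩ : ∃ k, ⌈t⌉₊ = k + 1 := Nat.exists_eq_succ_of_ne_zero (Nat.ceil_pos.2 ht).ne'
  have hkd : k + 1 ≤ d := by rw [← hk]; exact Nat.ceil_le.2 htd
  -- Direction `i` is cut into at most `2R/δ_i + 1 ≤ (2R + 1)/δ_i` intervals; `d^t` comes from the
  -- diameter bound `d α`.
  refine ⟨(2 * R + 1) ^ d * (d : ℝ) ^ t, by positivity, fun T hT => ?_⟩
  obtain ⟨e, he⟩ := exists_singular_basis T
  set α := singVal T k with hα
  have hαpos : 0 < α := singVal_pos hT (by omega)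
  -- Side lengths in singular coordinates: `T` stretches side `δ_i` to at most `α`. Only the first
  -- `k` directions need sides shorter than 1.
  set δ : ℕ → ℝ := fun i => min 1 (α / singVal T i) with hδ
  have hδpos : ∀ i < d, 0 < δ i := fun i hi =>
    lt_min one_pos (div_pos hαpos (singVal_pos hT hi))
  let n : Fin d → ℕ := fun i => ⌊2 * R / δ i⌋₊ + 1
  refine ⟨∀ i, Fin (n i), inferInstance,
    fun j => T '' {x | ‖x‖ ≤ R ∧ ∀ i : Fin d, ⌊(e.repr x i + R) / δ i⌋₊ = j i}, d * α,
    by positivity, ?_, ?_, ?_, ?_⟩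
  · exact mul_le_mul_of_nonneg_left (singVal_le_norm T k) (Nat.cast_nonneg d)
  · rintro _ ⟨x, hx, rfl⟩
    have hx' : ‖x‖ ≤ R := by simpa using hx
    refine mem_iUnion.2 ⟨fun i => ⟨⌊(e.repr x i + R) / δ i⌋₊, Nat.lt_succ_of_le
      (Nat.floor_le_floor ?_)⟩, x, ⟨hx', fun i => rfl⟩, rfl⟩
    have h1 := (abs_le.1 ((abs_repr_le_norm e x i).trans hx')).2
    exact div_le_div_of_nonneg_right (by linarith) (hδpos i i.2).le
  · rintro j _ ⟨x, ⟨hxR, hx⟩, rfl⟩ _ ⟨y, ⟨hyR, hy⟩, rfl⟩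
    rw [dist_eq_norm, ← map_sub]
    refine le_of_sq_le_sq ?_ (by positivity)
    rw [norm_sq_apply_eq_sum he]
    calc ∑ i : Fin d, singVal T i ^ 2 * (e.repr (x - y) i) ^ 2 ≤ ∑ _i : Fin d, α ^ 2 := by
          refine Finset.sum_le_sum fun i _ => ?_
          rw [← mul_pow, ← sq_abs]
          refine pow_le_pow_left₀ (abs_nonneg _) ?_ 2
          rw [abs_mul, abs_of_nonneg (singVal_nonneg T i)]
          have hδi := hδpos i i.2
          have h1 : |e.repr (x - y) i| ≤ δ i := by
            have hx0 : 0 ≤ (e.repr x i + R) / δ i := div_nonneg (by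
              have := (abs_le.1 ((abs_repr_le_norm e x i).trans hxR)).1
              linarith) hδi.le
            have hy0 : 0 ≤ (e.repr y i + R) / δ i := div_nonneg (by
              have := (abs_le.1 ((abs_repr_le_norm e y i).trans hyR)).1
              linarith) hδi.le
            have hx1 := Nat.floor_le hx0
            have hx2 := Nat.lt_floor_add_one ((e.repr x i + R) / δ i)
            have hy1 := Nat.floor_le hy0
            have hy2 := Nat.lt_floor_add_one ((e.repr y i + R) / δ i)
            rw [hx i] at hx1 hx2
            rw [hy i] at hy1 hy2
            rw [le_div_iff₀ hδi] at hx1 hy1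
            rw [div_lt_iff₀ hδi] at hx2 hy2
            rw [map_sub, PiLp.sub_apply, abs_le]
            constructor <;> linarith
          calc singVal T i * |e.repr (x - y) i| ≤ singVal T i * (α / singVal T i) :=
                mul_le_mul_of_nonneg_left (h1.trans (min_le_right _ _)) (singVal_nonneg T i)
            _ = α := mul_div_cancel₀ _ (singVal_pos hT i.2).ne'
      _ = d * α ^ 2 := by simp
      _ ≤ (d * α) ^ 2 := by
          rw [mul_pow]
          refine mul_le_mul_of_nonneg_right ?_ (sq_nonneg α)
          have : (1 : ℝ) ≤ d := by exact_mod_cast (by omega : 1 ≤ d)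
          nlinarith
  · have hprod : ∏ i ∈ Finset.range d, (δ i)⁻¹ = topProd k T / α ^ k := by
      rw [← Finset.prod_subset (Finset.range_mono (by omega : k ≤ d)), topProd]
      · rw [← Finset.card_range k, ← Finset.prod_const, Finset.card_range,
          ← Finset.prod_div_distrib]
        refine Finset.prod_congr rfl fun i hi => ?_
        have hi := Finset.mem_range.1 hi
        rw [hδ]
        simp only
        rw [min_eq_right, inv_div]
        rw [div_le_one (singVal_pos hT (by omega))]
        exact singVal_antitone T hi.le
      · intro i hid hi
        have hi := not_lt.1 (fun h => hi (Finset.mem_range.2 h))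
        rw [hδ]
        simp only
        rw [min_eq_left, inv_one]
        rw [le_div_iff₀ (singVal_pos hT (Finset.mem_range.1 hid)), one_mul]
        exact singVal_antitone T hi
    have hcard : (Fintype.card (∀ i, Fin (n i)) : ℝ) ≤
        (2 * R + 1) ^ d * (topProd k T / α ^ k) := by
      rw [← hprod, Fintype.card_pi]
      push_cast
      rw [← Fin.prod_univ_eq_prod_range, ← Fin.prod_const, ← Finset.prod_mul_distrib]
      refine Finset.prod_le_prod (fun i _ => Nat.cast_nonneg _) fun i _ => ?_
      have hδi := hδpos i i.2
      simp only [Fintype.card_fin, n]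
      push_cast
      have h1 : (⌊2 * R / δ i⌋₊ : ℝ) ≤ 2 * R / δ i := Nat.floor_le (by positivity)
      have h2 : 1 ≤ (δ i)⁻¹ := (one_le_inv₀ hδi).2 (min_le_left _ _)
      have h3 : 2 * R / δ i = 2 * R * (δ i)⁻¹ := div_eq_mul_inv _ _
      linarith
    have hsvf : svf t T = topProd k T * α ^ (t - k) := by
      rw [svf, if_neg ht.not_ge, if_pos htd, hk]
      simp only [add_tsub_cancel_right]
      rw [topProd, ← hα]
      congr 2
      push_cast; ring
    rw [Real.mul_rpow (Nat.cast_nonneg d) hαpos.le]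
    refine (mul_le_mul_of_nonneg_right hcard (by positivity)).trans_eq ?_
    rw [hsvf, Real.rpow_sub hαpos, Real.rpow_natCast]
    ring

/-- Points whose codes share the prefix `u` differ by `T_u` applied to a difference of two coded
points, each of norm at most `2‖a‖`. -/
theorem range_coding_subset (hM : 1 ≤ M) (hn : ∀ j, ‖T j‖ < 1 / 2) (a : Fin M → E d) (n : ℕ) :
    ∃ z : (Fin n → Fin M) → E d, range (coding T a) ⊆ ⋃ u : Fin n → Fin M,
      (fun x => z u + x) '' (wordMap T (List.ofFn u) '' Metric.closedBall 0 (4 * ‖a‖)) := by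
  let v : (Fin n → Fin M) → ℕ → Fin M := fun u i => if h : i < n then u ⟨i, h⟩ else ⟨0, hM⟩
  refine ⟨fun u => coding T a (v u), ?_⟩
  rintro _ ⟨w, rfl⟩
  refine mem_iUnion.2 ⟨fun i => w i, _, ⟨coding T a (fun k => w (k + n)) -
    coding T a (fun k => v (fun i => w i) (k + n)), ?_, rfl⟩, ?_⟩
  · rw [mem_closedBall_zero_iff]
    refine (norm_sub_le _ _).trans ?_
    have h1 := norm_coding_le hn a (fun k => w (k + n))
    have h2 := norm_coding_le hn a (fun k => v (fun i => w i) (k + n))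
    linarith
  · have h := coding_sub_coding hn a (v := w) (w := v fun i => w i) n (fun i hi => by simp [v, hi])
    change _ + wordMap T (initWord w n) _ = _
    rw [← h]
    abel

theorem dimH_range_coding_le_of_growth_lt_one (hd : 1 ≤ d) (hM : 1 ≤ M)
    (hT : ∀ j, (T j).det ≠ 0) (hn : ∀ j, ‖T j‖ < 1 / 2) {t : ℝ} (ht : 0 < t) (htd : t ≤ d)
    (h : growth T t < 1) (a : Fin M → E d) :
    dimH (range (coding T a)) ≤ ENNReal.ofReal t := by
  obtain ⟨C, hC, hcov⟩ := exists_cover_image_closedBall (R := 4 * ‖a‖) ht htd (by positivity)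
  choose ι hι B ρ hρ0 hρ hB hdist hcard using hcov
  choose z hz using range_coding_subset hM hn a
  have hdet : ∀ u : List (Fin M), (wordMap T u).det ≠ 0 := det_wordMap_ne_zero hT
  let I : ℕ → Type := fun n => Σ u : Fin n → Fin M, ι (wordMap T (List.ofFn u)) (hdet _)
  let t' : ∀ n, I n → Set (E d) := fun n p => (fun x => z n p.1 + x) '' B _ (hdet _) p.2
  have hdiam : ∀ n (p : I n), Metric.ediam (t' n p) ≤ ENNReal.ofReal (ρ _ (hdet (List.ofFn p.1))) := by
    rintro n ⟨u, i⟩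
    refine Metric.ediam_le ?_
    rintro _ ⟨x, hx, rfl⟩ _ ⟨y, hy, rfl⟩
    rw [edist_dist]
    refine ENNReal.ofReal_le_ofReal ?_
    rw [dist_add_left]
    exact hdist _ (hdet _) i x hx y hy
  have hmeas : μH[t] (range (coding T a)) ≤ 0 := by
    refine (Measure.hausdorffMeasure_le_liminf_sum t (range (coding T a)) (l := atTop)
      (fun n => ENNReal.ofReal (d * (1 / 2 : ℝ) ^ n)) ?_ t' ?_ ?_).trans ?_
    · have h1 : Tendsto (fun n : ℕ => (d : ℝ) * (1 / 2 : ℝ) ^ n) atTop (𝓝 (d * 0)) :=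
        (tendsto_pow_atTop_nhds_zero_of_lt_one (by norm_num) (by norm_num)).const_mul _
      simpa using ENNReal.tendsto_ofReal h1
    · refine Eventually.of_forall fun n p => (hdiam n p).trans (ENNReal.ofReal_le_ofReal ?_)
      refine (hρ _ _).trans (mul_le_mul_of_nonneg_left ?_ (Nat.cast_nonneg d))
      simpa using norm_wordMap_le_half_pow hn (List.ofFn p.1)
    · refine Eventually.of_forall fun n x hx => ?_
      obtain ⟨u, y, hy, rfl⟩ := mem_iUnion.1 (hz n hx)
      obtain ⟨i, hi⟩ := mem_iUnion.1 (hB _ (hdet _) hy)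
      exact mem_iUnion.2 ⟨⟨u, i⟩, y, hi, rfl⟩
    -- The `t`-th powers of the diameters at level `n` add up to at most `C` times the level sum,
    -- which tends to 0.
    · have h1 : Tendsto (fun n => ENNReal.ofReal (C * levelSum T t n)) atTop (𝓝 0) := by
        simpa using ENNReal.tendsto_ofReal
          ((tendsto_levelSum_zero hd hM hT hn ht.le h).const_mul C)
      rw [← h1.liminf_eq]
      refine liminf_le_liminf (Eventually.of_forall fun n => ?_)
      rw [levelSum, Finset.mul_sum, ENNReal.ofReal_sum_of_nonneg fun _ _ =>
        mul_nonneg hC (svf_nonneg _ ht.le), Fintype.sum_sigma]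
      refine Finset.sum_le_sum fun u _ => ?_
      calc ∑ i, Metric.ediam (t' n ⟨u, i⟩) ^ t
          ≤ ∑ _i : ι (wordMap T (List.ofFn u)) (hdet _),
            ENNReal.ofReal (ρ _ (hdet (List.ofFn u)) ^ t) := by
            refine Finset.sum_le_sum fun i _ => ?_
            rw [← ENNReal.ofReal_rpow_of_nonneg (hρ0 _ _) ht.le]
            exact ENNReal.rpow_le_rpow (hdiam n ⟨u, i⟩) ht.le
        _ = ENNReal.ofReal (Fintype.card (ι (wordMap T (List.ofFn u)) (hdet _)) *
            ρ _ (hdet (List.ofFn u)) ^ t) := by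
            rw [Finset.sum_const, Finset.card_univ, nsmul_eq_mul,
              ENNReal.ofReal_mul (Nat.cast_nonneg _), ENNReal.ofReal_natCast]
        _ ≤ _ := ENNReal.ofReal_le_ofReal (hcard _ _)
  rw [ENNReal.ofReal]
  refine dimH_le_of_hausdorffMeasure_ne_top ?_
  rw [Real.coe_toNNReal _ ht.le, le_antisymm hmeas bot_le]
  exact ENNReal.zero_ne_top

/-- For `s_A = d` the ambient dimension suffices; otherwise let `t < d` decrease to `s_A`. -/
theorem dimH_range_coding_le (hd : 1 ≤ d) (hM : 2 ≤ M) (hT : ∀ j, (T j).det ≠ 0)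
    (hn : ∀ j, ‖T j‖ < 1 / 2) (h : sA T ≤ d) (a : Fin M → E d) :
    dimH (range (coding T a)) ≤ ENNReal.ofReal (sA T) := by
  have hM1 : 1 ≤ M := by omega
  rcases h.eq_or_lt with h | h
  · rw [h, ENNReal.ofReal_natCast]
    refine (dimH_mono (subset_univ _)).trans ?_
    rw [Real.dimH_univ_eq_finrank]
    simp
  · have hlim : Tendsto (fun t => ENNReal.ofReal t) (𝓝[>] (sA T)) (𝓝 (ENNReal.ofReal (sA T))) :=
      (ENNReal.continuous_ofReal.tendsto _).mono_left nhdsWithin_le_nhds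
    refine ge_of_tendsto hlim ?_
    have h1 : ∀ᶠ t : ℝ in 𝓝[>] (sA T), t < d := (eventually_lt_nhds h).filter_mono nhdsWithin_le_nhds
    filter_upwards [h1, self_mem_nhdsWithin] with t ht1 ht2
    refine dimH_range_coding_le_of_growth_lt_one hd hM1 hT hn
      ((sA_pos hd hM hT hn).trans ht2) ht1.le ?_ a
    rw [← growth_sA hd hM hT hn]
    exact growth_strictAnti hd hM1 hT hn (sA_nonneg hd hM1 hT hn) ht2

end UpperBound

/-! ### A Frostman measure on the space of words -/

section Frostman

variable {d M : ℕ} {T : Fin M → (E d →L[ℝ] E d)}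

theorem netPremeasure_cylinder_le (T : Fin M → (E d →L[ℝ] E d)) (s : ℝ) (u : List (Fin M)) :
    netPremeasure T s 0 (cylinder u) ≤ ENNReal.ofReal (svf s (wordMap T u)) := by
  have h : (∀ v ∈ ({u} : Set (List (Fin M))), 0 ≤ v.length) ∧
      cylinder u ⊆ ⋃ v ∈ ({u} : Set (List (Fin M))), cylinder v := by simp
  refine le_trans (iInf₂_le ({u} : Set (List (Fin M))) h) ?_
  rw [tsum_singleton u fun v => ENNReal.ofReal (svf s (wordMap T v))]

theorem netPremeasure_mono (T : Fin M → (E d →L[ℝ] E d)) (s : ℝ) (k : ℕ)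
    {G H : Set (ℕ → Fin M)} (h : G ⊆ H) : netPremeasure T s k G ≤ netPremeasure T s k H :=
  le_iInf₂ fun A hA => iInf₂_le A ⟨hA.1, h.trans hA.2⟩

theorem netPremeasure_iUnion_le (T : Fin M → (E d →L[ℝ] E d)) (s : ℝ) (k : ℕ) {ι : Type*}
    [Fintype ι] (G : ι → Set (ℕ → Fin M)) :
    netPremeasure T s k (⋃ i, G i) ≤ ∑ i, netPremeasure T s k (G i) := by
  classical
  have key : ∀ t : Finset ι, netPremeasure T s k (⋃ i ∈ t, G i) ≤
      ∑ i ∈ t, netPremeasure T s k (G i) := by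
    intro t
    induction t using Finset.induction_on with
    | empty =>
      have h : (∀ v ∈ (∅ : Set (List (Fin M))), k ≤ v.length) ∧
          (⋃ i ∈ (∅ : Finset ι), G i) ⊆ ⋃ v ∈ (∅ : Set (List (Fin M))), cylinder v := by simp
      refine le_trans (iInf₂_le (∅ : Set (List (Fin M))) h) ?_
      simp
    | insert i t hi ih =>
      rw [Finset.sum_insert hi, Finset.set_biUnion_insert]
      refine le_trans ?_ (add_le_add_right ih _)
      generalize (⋃ j ∈ t, G j) = H
      simp only [netPremeasure, ENNReal.iInf_add, ENNReal.add_iInf]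
      refine le_iInf₂ fun A hA => le_iInf₂ fun B hB => ?_
      have h : (∀ v ∈ B ∪ A, k ≤ v.length) ∧ G i ∪ H ⊆ ⋃ v ∈ B ∪ A, cylinder v := by
        refine ⟨fun v hv => hv.elim (hB.1 v) (hA.1 v), ?_⟩
        rw [biUnion_union]
        exact union_subset_union hB.2 hA.2
      exact (iInf₂_le (B ∪ A) h).trans
        (ENNReal.tsum_union_le (fun v => ENNReal.ofReal (svf s (wordMap T v))) B A)
  simpa using key Finset.univ

theorem cylinder_append_subset (u v : List (Fin M)) : cylinder (u ++ v) ⊆ cylinder u := by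
  intro w hw i hi
  rw [hw i (by rw [List.length_append]; omega), List.getElem_append_left hi]

theorem cylinder_subset_iUnion (u : List (Fin M)) :
    cylinder u ⊆ ⋃ i, cylinder (u ++ [i]) := by
  intro w hw
  refine mem_iUnion.2 ⟨w u.length, fun i hi => ?_⟩
  rw [List.length_append, List.length_singleton] at hi
  rcases (Nat.lt_succ_iff.1 hi).lt_or_eq with h | rfl
  · rw [hw i h, List.getElem_append_left h]
  · simp

theorem disjoint_cylinder_append (u v : List (Fin M)) {i j : Fin M} (h : i ≠ j) :
    cylinder (u ++ i :: v) ⊆ (cylinder (u ++ [j]))ᶜ := by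
  intro w hw hw'
  have h1 := hw u.length (by simp)
  have h2 := hw' u.length (by simp)
  simp only [List.getElem_append_right le_rfl, Nat.sub_self, List.getElem_cons_zero] at h1 h2
  exact h (h1.symm.trans h2)

@[simp] theorem cylinder_nil : cylinder ([] : List (Fin M)) = univ := by
  ext; simp [cylinder]

theorem cylinder_nonempty (hM : 1 ≤ M) (u : List (Fin M)) : (cylinder u).Nonempty := by
  refine ⟨fun i => u.getD i ⟨0, hM⟩, fun i hi => ?_⟩
  simp [hi]

/-- Since `φ^s(T_u) ≥ (δ^s)^{|u|}`, a cover of total weight below `(δ^s)^k` contains no word shorter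
than `k`. Vanishing without a length restriction would thus force the net measure to vanish. -/
theorem netPremeasure_zero_univ_ne_zero (hd : 1 ≤ d) (hM : 1 ≤ M) (hT : ∀ j, (T j).det ≠ 0)
    (hn : ∀ j, ‖T j‖ < 1 / 2) {s : ℝ} (hs : 0 ≤ s) (h : s < sA T) :
    netPremeasure T s 0 univ ≠ 0 := by
  intro h0
  refine netMeasure_ne_zero_of_lt_sA hd hM hT hn hs h
    (le_antisymm (iSup_le fun k => ?_) bot_le)
  obtain ⟨δ, hδ, hδ1, hδT⟩ := exists_pos_le_abs_det hM hT
  have hδs : 0 < δ ^ s := Real.rpow_pos_of_pos hδ s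
  refine le_of_forall_pos_le_add fun ε hε => ?_
  have hlt : netPremeasure T s 0 univ < min ε (ENNReal.ofReal ((δ ^ s) ^ k)) := by
    rw [h0]
    exact lt_min hε (by simpa using pow_pos hδs k)
  simp only [netPremeasure, iInf_lt_iff] at hlt
  obtain ⟨A, ⟨-, hA2⟩, hA⟩ := hlt
  have hlen : ∀ u ∈ A, k ≤ u.length := by
    intro u hu
    by_contra hk
    have h1 := (ENNReal.le_tsum (f := fun u : A => ENNReal.ofReal (svf s (wordMap T u)))
      ⟨u, hu⟩).trans_lt (hA.trans_le (min_le_right _ _))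
    rw [ENNReal.ofReal_lt_ofReal_iff (pow_pos hδs k)] at h1
    refine h1.not_ge (le_trans ?_ (pow_le_svf_wordMap hd hT hn hδ hδT hs u))
    exact pow_le_pow_of_le_one hδs.le (Real.rpow_le_one hδ.le hδ1 hs) (not_le.1 hk).le
  rw [zero_add]
  exact (iInf₂_le A ⟨hlen, hA2⟩).trans (hA.le.trans (min_le_left _ _))

/-- Finite-depth approximations of a Frostman measure. -/
theorem exists_measure_le_netPremeasure (hM : 1 ≤ M) (T : Fin M → (E d →L[ℝ] E d)) (s : ℝ)
    (N : ℕ) (u : List (Fin M)) : ∃ ν : Measure (ℕ → Fin M),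
      ν univ = netPremeasure T s 0 (cylinder u) ∧ ν (cylinder u)ᶜ = 0 ∧
      ∀ v : List (Fin M), v.length ≤ N →
        ν (cylinder (u ++ v)) ≤ netPremeasure T s 0 (cylinder (u ++ v)) := by
  induction N generalizing u with
  | zero =>
    obtain ⟨x, hx⟩ := cylinder_nonempty hM u
    refine ⟨netPremeasure T s 0 (cylinder u) • Measure.dirac x, by simp, ?_, ?_⟩
    · rw [Measure.smul_apply, Measure.dirac_apply' _ (isClopen_cylinder u).isOpen.measurableSet.compl]
      simp [hx]
    · intro v hv
      obtain rfl : v = [] := by simpa using hv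
      rw [List.append_nil]
      refine (measure_mono (subset_univ _)).trans_eq ?_
      simp
  | succ N ih =>
    -- Measures on the child cylinders are added and rescaled to the mass prescribed at `u`. By
    -- subadditivity the factor `c` is at most 1, so the bounds on longer cylinders survive.
    choose ν hν1 hν2 hν3 using fun i => ih (u ++ [i])
    set f : List (Fin M) → ℝ≥0∞ := fun u => netPremeasure T s 0 (cylinder u) with hf
    have hle : f u ≤ ∑ i, f (u ++ [i]) :=
      (netPremeasure_mono T s 0 (cylinder_subset_iUnion u)).trans (netPremeasure_iUnion_le T s 0 _)
    have htop : ∑ i, f (u ++ [i]) ≠ ∞ := by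
      refine ENNReal.sum_ne_top.2 fun i _ => ?_
      exact ((netPremeasure_cylinder_le T s _).trans_lt ENNReal.ofReal_lt_top).ne
    set c : ℝ≥0∞ := f u / ∑ i, f (u ++ [i]) with hc
    have hc1 : c ≤ 1 := ENNReal.div_le_of_le_mul (by rwa [one_mul])
    have htot : (c • ∑ i, ν i) univ = f u := by
      rw [Measure.smul_apply, Measure.finsetSum_apply, smul_eq_mul]
      simp only [hν1]
      change c * ∑ i, f (u ++ [i]) = f u
      -- If all children carry no content, neither does `u`, and the quotient `0 / 0` is harmless.
      by_cases h0 : ∑ i, f (u ++ [i]) = 0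
      · rw [h0] at hle ⊢
        rw [mul_zero, le_antisymm hle bot_le]
      · exact ENNReal.div_mul_cancel h0 htop
    refine ⟨c • ∑ i, ν i, htot, ?_, ?_⟩
    · rw [Measure.smul_apply, Measure.finsetSum_apply, Finset.sum_eq_zero, smul_zero]
      intro i _
      exact measure_mono_null (compl_subset_compl.2 (cylinder_append_subset u [i])) (hν2 i)
    · intro v hv
      cases v with
      | nil =>
        rw [List.append_nil]
        exact (measure_mono (subset_univ _)).trans_eq htot
      | cons i v =>
        rw [Measure.smul_apply, Measure.finsetSum_apply, Finset.sum_eq_single i]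
        · have h1 := hν3 i v (by simpa using hv)
          rw [List.append_assoc, List.singleton_append] at h1
          exact (mul_le_of_le_one_left bot_le hc1).trans h1
        · intro j _ hj
          exact measure_mono_null (disjoint_cylinder_append u v hj.symm) (hν2 j)
        · simp

theorem exists_frostman_measure (hd : 1 ≤ d) (hM : 1 ≤ M) (hT : ∀ j, (T j).det ≠ 0)
    (hn : ∀ j, ‖T j‖ < 1 / 2) {s : ℝ} (hs : 0 ≤ s) (h : s < sA T) :
    ∃ μ : Measure (ℕ → Fin M), IsProbabilityMeasure μ ∧ ∃ K : ℝ≥0∞, K ≠ ∞ ∧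
      ∀ u, μ (cylinder u) ≤ K * ENNReal.ofReal (svf s (wordMap T u)) := by
  have h0 := netPremeasure_zero_univ_ne_zero hd hM hT hn hs h
  set F := netPremeasure T s 0 (univ : Set (ℕ → Fin M)) with hF
  have hFtop : F ≠ ∞ := by
    have h1 := netPremeasure_cylinder_le T s []
    rw [cylinder_nil] at h1
    exact (h1.trans_lt ENNReal.ofReal_lt_top).ne
  choose ν hν1 hν2 hν3 using fun N => exists_measure_le_netPremeasure hM T s N []
  simp only [cylinder_nil, List.nil_append, ← hF] at hν1 hν3
  let P : ℕ → ProbabilityMeasure (ℕ → Fin M) := fun N => ⟨F⁻¹ • ν N, ⟨by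
    rw [Measure.smul_apply, hν1, smul_eq_mul, ENNReal.inv_mul_cancel h0 hFtop]⟩⟩
  -- Weak compactness of the probability measures on a compact space. Cylinders are clopen, so their
  -- masses converge along the ultrafilter.
  obtain ⟨Q, -, hQ⟩ := isCompact_univ.ultrafilter_le_nhds
    (Ultrafilter.map P (hyperfilter ℕ)) (by simp)
  have hQ' : Tendsto P (hyperfilter ℕ) (𝓝 Q) := hQ
  refine ⟨Q, inferInstance, F⁻¹, ENNReal.inv_ne_top.2 h0, fun u => ?_⟩
  have h1 := ProbabilityMeasure.tendsto_measure_of_null_frontier_of_tendsto' hQ'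
    (E := cylinder u) (by simp [(isClopen_cylinder u).frontier_eq])
  refine le_of_tendsto h1 ?_
  have h2 : ∀ᶠ N in (hyperfilter ℕ : Filter ℕ), u.length ≤ N :=
    (Nat.hyperfilter_le_atTop) (eventually_ge_atTop u.length)
  filter_upwards [h2] with N hN
  change F⁻¹ * ν N (cylinder u) ≤ _
  exact mul_le_mul_right ((hν3 N u hN).trans (netPremeasure_cylinder_le T s u)) _

end Frostman

/-! ### Transversality in the translation parameters -/

section Transversality

variable {d M : ℕ} {T : Fin M → (E d →L[ℝ] E d)}

/-- In right singular coordinates the set lies in a box with half-sides `R min(1, r / α_i)`. -/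
theorem volume_norm_apply_le (hd : 1 ≤ d) {S : E d →L[ℝ] E d} (hS : S.det ≠ 0) {s R r : ℝ}
    (hs : 0 ≤ s) (hsd : s ≤ d) (hR : 1 ≤ R) (hr : 0 < r) :
    volume {x : E d | ‖x‖ ≤ R ∧ ‖S x‖ ≤ r} ≤
      ENNReal.ofReal ((2 * R) ^ d * (r ^ s / svf s S)) := by
  obtain ⟨e, he⟩ := exists_singular_basis S
  let b : Fin d → ℝ := fun i => R * min 1 (r / singVal S i)
  have hb : ∀ i, 0 ≤ b i := fun i => mul_nonneg (by linarith)
    (le_min zero_le_one (div_nonneg hr.le (singVal_nonneg S i)))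
  have hsub : {x : E d | ‖x‖ ≤ R ∧ ‖S x‖ ≤ r} ⊆
      (fun x => WithLp.ofLp (e.repr x)) ⁻¹' (univ.pi fun i => Metric.closedBall 0 (b i)) := by
    rintro x ⟨hx1, hx2⟩ i -
    rw [mem_closedBall_zero_iff, Real.norm_eq_abs]
    have h1 : |e.repr x i| ≤ R := (abs_repr_le_norm e x i).trans hx1
    have hp := singVal_pos hS i.2
    have h2 : |e.repr x i| ≤ r / singVal S i := by
      rw [le_div_iff₀ hp]
      refine le_trans (le_of_sq_le_sq ?_ (norm_nonneg (S x))) hx2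
      rw [norm_sq_apply_eq_sum he, mul_pow, sq_abs, mul_comm]
      exact Finset.single_le_sum (f := fun i : Fin d => singVal S i ^ 2 * e.repr x i ^ 2)
        (fun i _ => by positivity) (Finset.mem_univ i)
    rw [show b i = R * min 1 (r / singVal S i) from rfl, mul_min_of_nonneg _ _ (by linarith)]
    refine le_min (by linarith) (h2.trans ?_)
    exact le_mul_of_one_le_left (div_nonneg hr.le hp.le) hR
  have hmp : MeasurePreserving (fun x : E d => WithLp.ofLp (e.repr x)) volume volume :=
    (PiLp.volume_preserving_ofLp (Fin d)).comp e.measurePreserving_repr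
  refine (measure_mono hsub).trans ?_
  rw [hmp.measure_preimage (MeasurableSet.univ_pi fun i =>
    Metric.isClosed_closedBall.measurableSet).nullMeasurableSet, volume_pi_pi]
  simp only [Real.volume_closedBall]
  rw [← ENNReal.ofReal_prod_of_nonneg fun i _ => mul_nonneg zero_le_two (hb i)]
  refine ENNReal.ofReal_le_ofReal ?_
  simp only [b, ← mul_assoc]
  rw [Finset.prod_mul_distrib, Fin.prod_const,
    Fin.prod_univ_eq_prod_range (fun i => min 1 (r / singVal S i))]
  exact mul_le_mul_of_nonneg_left (prod_min_one_div_le hd hS hs hsd hr) (by positivity)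

/-- Write `S = (S B) B⁻¹` with `‖B⁻¹‖ ≤ κ⁻¹` and use submultiplicativity. -/
theorem svf_le_svf_mul_of_le_norm (hd : 1 ≤ d) (S : E d →L[ℝ] E d) {B : E d →L[ℝ] E d} {κ s : ℝ}
    (hs : 0 ≤ s) (hκ : 0 < κ) (hB : ∀ x, κ * ‖x‖ ≤ ‖B x‖) :
    B.det ≠ 0 ∧ svf s S ≤ svf s (S * B) * κ⁻¹ ^ s := by
  have hinj : Function.Injective (B : E d →ₗ[ℝ] E d) := by
    refine (injective_iff_map_eq_zero _).2 fun x hx => ?_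
    have h1 := hB x
    rw [show B x = 0 from hx, norm_zero] at h1
    exact norm_le_zero_iff.1 (by nlinarith [norm_nonneg x])
  let L := LinearEquiv.ofInjectiveEndo (B : E d →ₗ[ℝ] E d) hinj
  let B' : E d →L[ℝ] E d := LinearMap.toContinuousLinearMap (L.symm : E d →ₗ[ℝ] E d)
  have hBB' : B * B' = 1 := by
    ext1 x
    change L (L.symm x) = x
    exact L.apply_symm_apply x
  have hdet : B.det * B'.det = 1 := by
    rw [← det_mul, hBB']
    simp [ContinuousLinearMap.det]
  have hB'norm : ‖B'‖ ≤ κ⁻¹ := by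
    refine ContinuousLinearMap.opNorm_le_bound _ (inv_nonneg.2 hκ.le) fun x => ?_
    have h1 := hB (B' x)
    rw [← mul_apply_eq_comp, hBB', one_apply_eq_self] at h1
    rw [inv_mul_eq_div, le_div_iff₀ hκ, mul_comm]
    exact h1
  refine ⟨left_ne_zero_of_mul_eq_one hdet, ?_⟩
  calc svf s S = svf s (S * B * B') := by rw [mul_assoc, hBB', mul_one]
    _ ≤ svf s (S * B) * svf s B' := svf_mul_le _ _ hs
    _ ≤ _ := by
      refine mul_le_mul_of_nonneg_left ((svf_le_norm_rpow hd
        (right_ne_zero_of_mul_eq_one hdet) hs).trans ?_) (svf_nonneg _ hs)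
      exact Real.rpow_le_rpow (norm_nonneg _) hB'norm hs

/-- A volume bound for the set where an affine image of `x` is moved close to `0` by `S`. -/
theorem volume_norm_apply_add_le (hd : 1 ≤ d) {S B : E d →L[ℝ] E d} (hS : S.det ≠ 0)
    {κ s ρ r : ℝ} (hs : 0 ≤ s) (hsd : s ≤ d) (hκ : 0 < κ) (hB : ∀ x, κ * ‖x‖ ≤ ‖B x‖)
    (hρ : 1 ≤ ρ) (hr : 0 < r) (z : E d) :
    volume {x : E d | ‖x‖ ≤ ρ ∧ ‖S (B x + z)‖ ≤ r} ≤
      ENNReal.ofReal ((4 * ρ) ^ d * 2 ^ s * κ⁻¹ ^ s * (r ^ s / svf s S)) := by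
  rcases eq_empty_or_nonempty {x : E d | ‖x‖ ≤ ρ ∧ ‖S (B x + z)‖ ≤ r} with h | ⟨x₀, hx₀⟩
  · rw [h, measure_empty]; exact bot_le
  obtain ⟨hBdet, hsvf⟩ := svf_le_svf_mul_of_le_norm hd S hs hκ hB
  have hSB : (S * B).det ≠ 0 := by rw [det_mul]; exact mul_ne_zero hS hBdet
  -- Subtracting one fixed point of the set removes the translation `z`, at the price of doubling
  -- both radii.
  have hsub : {x : E d | ‖x‖ ≤ ρ ∧ ‖S (B x + z)‖ ≤ r} ⊆
      (fun x => x + -x₀) ⁻¹' {x | ‖x‖ ≤ 2 * ρ ∧ ‖(S * B) x‖ ≤ 2 * r} := by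
    rintro x ⟨hx1, hx2⟩
    constructor
    · have := norm_sub_le x x₀
      rw [sub_eq_add_neg] at this
      linarith [hx₀.1]
    · have h1 : (S * B) (x + -x₀) = S (B x + z) - S (B x₀ + z) := by
        simp only [mul_apply_eq_comp, map_add, map_neg]
        abel
      rw [h1]
      have := norm_sub_le (S (B x + z)) (S (B x₀ + z))
      linarith [hx₀.2]
  refine (measure_mono hsub).trans ?_
  rw [measure_preimage_add_right]
  refine (volume_norm_apply_le hd hSB hs hsd (by linarith) (by linarith)).trans
    (ENNReal.ofReal_le_ofReal ?_)
  have hpos := svf_pos hS hs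
  have hpos' := svf_pos hSB hs
  have h1 : (svf s (S * B))⁻¹ ≤ κ⁻¹ ^ s * (svf s S)⁻¹ := by
    rw [← div_eq_mul_inv, le_div_iff₀ hpos, inv_mul_le_iff₀ hpos']
    exact hsvf
  rw [Real.mul_rpow zero_le_two hr.le, show 2 * (2 * ρ) = 4 * ρ by ring]
  calc (4 * ρ) ^ d * (2 ^ s * r ^ s / svf s (S * B))
      = (4 * ρ) ^ d * (2 ^ s * r ^ s) * (svf s (S * B))⁻¹ := by ring
    _ ≤ (4 * ρ) ^ d * (2 ^ s * r ^ s) * (κ⁻¹ ^ s * (svf s S)⁻¹) :=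
        mul_le_mul_of_nonneg_left h1 (by positivity)
    _ = _ := by ring

theorem coding_add (hn : ∀ j, ‖T j‖ < 1 / 2) (a b : Fin M → E d) (v : ℕ → Fin M) :
    coding T (a + b) v = coding T a v + coding T b v := by
  rw [coding, coding, coding, ← (summable_coding hn a v).tsum_add (summable_coding hn b v)]
  simp

theorem coding_smul (c : ℝ) (a : Fin M → E d) (v : ℕ → Fin M) :
    coding T (c • a) v = c • coding T a v := by
  rw [coding, coding, ← tsum_const_smul'']
  simp

/-- The coefficient of `a_i` in `π_a(v) - π_a(w)`. -/
noncomputable def codingDiff (hn : ∀ j, ‖T j‖ < 1 / 2) (v w : ℕ → Fin M) (i : Fin M) :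
    E d →L[ℝ] E d :=
  LinearMap.toContinuousLinearMap
    { toFun := fun x => coding T (Pi.single i x) v - coding T (Pi.single i x) w
      map_add' := fun x y => by
        rw [Pi.single_add, coding_add hn, coding_add hn]; abel
      map_smul' := fun c x => by
        rw [Pi.single_smul, coding_smul, coding_smul, RingHom.id_apply, smul_sub] }

theorem codingDiff_apply (hn : ∀ j, ‖T j‖ < 1 / 2) (v w : ℕ → Fin M) (i : Fin M) (x : E d) :
    codingDiff hn v w i x = coding T (Pi.single i x) v - coding T (Pi.single i x) w := rfl

theorem coding_update_sub (hn : ∀ j, ‖T j‖ < 1 / 2) (v w : ℕ → Fin M) (i : Fin M)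
    (a : Fin M → E d) (x : E d) :
    coding T (Function.update a i x) v - coding T (Function.update a i x) w =
      codingDiff hn v w i x +
        (coding T (Function.update a i 0) v - coding T (Function.update a i 0) w) := by
  have h : Function.update a i x = Pi.single i x + Function.update a i 0 := by
    ext1 j
    by_cases hj : j = i
    · subst hj; simp
    · simp [hj]
  rw [h, coding_add hn, coding_add hn, codingDiff_apply]
  abel

/-- The contribution of the letters `i` after the first position. -/
noncomputable def tailWeight (c : ℝ) (v : ℕ → Fin M) (i : Fin M) : ℝ :=
  ∑' k : ℕ, if v (k + 1) = i then c ^ (k + 1) else 0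

theorem summable_tailWeight {c : ℝ} (hc0 : 0 ≤ c) (hc : c < 1) (v : ℕ → Fin M) (i : Fin M) :
    Summable fun k : ℕ => if v (k + 1) = i then c ^ (k + 1) else 0 := by
  refine Summable.of_nonneg_of_le (fun k => ?_) (fun k => ?_)
    ((summable_nat_add_iff 1).2 (summable_geometric_of_lt_one hc0 hc))
  · split_ifs <;> positivity
  · split_ifs
    · exact le_rfl
    · positivity

/-- A position holds at most one of two distinct letters, so the two sums use disjoint terms of a
geometric series. -/
theorem tailWeight_add_le {c : ℝ} (hc0 : 0 ≤ c) (hc : c < 1) (v : ℕ → Fin M) {i j : Fin M}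
    (hij : i ≠ j) : tailWeight c v i + tailWeight c v j ≤ c / (1 - c) := by
  have hg : Summable fun k : ℕ => c ^ (k + 1) :=
    (summable_nat_add_iff 1).2 (summable_geometric_of_lt_one hc0 hc)
  have h1 : ∑' k : ℕ, c ^ (k + 1) = c / (1 - c) := by
    simp only [pow_succ']
    rw [tsum_mul_left, tsum_geometric_of_lt_one hc0 hc, div_eq_mul_inv]
  rw [tailWeight, tailWeight, ← (summable_tailWeight hc0 hc v i).tsum_add
    (summable_tailWeight hc0 hc v j), ← h1]
  refine Summable.tsum_le_tsum (fun k => ?_)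
    ((summable_tailWeight hc0 hc v i).add (summable_tailWeight hc0 hc v j)) hg
  by_cases hi : v (k + 1) = i
  · rw [if_pos hi, if_neg (by rw [hi]; exact hij), add_zero]
  · rw [if_neg hi, zero_add]
    split_ifs
    · exact le_rfl
    · positivity

theorem norm_coding_single_sub_le (hn : ∀ j, ‖T j‖ < 1 / 2) {c : ℝ} (hc0 : 0 ≤ c) (hc : c < 1)
    (hcT : ∀ j, ‖T j‖ ≤ c) (v : ℕ → Fin M) (i : Fin M) (x : E d) :
    ‖coding T (Pi.single i x) v - (if v 0 = i then x else 0)‖ ≤ tailWeight c v i * ‖x‖ := by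
  have h1 : coding T (Pi.single i x) v - (if v 0 = i then x else 0) =
      ∑' k, wordMap T (initWord v (k + 1)) ((Pi.single i x : Fin M → E d) (v (k + 1))) := by
    rw [coding, (summable_coding hn _ v).tsum_eq_zero_add]
    by_cases h : v 0 = i
    · subst h; simp
    · simp [h]
  rw [h1]
  refine tsum_of_norm_bounded ((summable_tailWeight hc0 hc v i).hasSum.mul_right ‖x‖) fun k => ?_
  by_cases h : v (k + 1) = i
  · rw [if_pos h, ← h, Pi.single_eq_same]
    refine (ContinuousLinearMap.le_opNorm _ _).trans
      (mul_le_mul_of_nonneg_right ?_ (norm_nonneg x))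
    simpa using norm_wordMap_le hc0 hcT (initWord v (k + 1))
  · simp [h]

/-- If `v` and `w` differ in the first letter, one of the coefficients is boundedly invertible. -/
theorem exists_le_norm_codingDiff (hn : ∀ j, ‖T j‖ < 1 / 2) {c : ℝ} (hc0 : 0 ≤ c) (hc : c < 1)
    (hcT : ∀ j, ‖T j‖ ≤ c) {v w : ℕ → Fin M} (hvw : v 0 ≠ w 0) :
    ∃ i, ∀ x, (1 - c / (1 - c)) * ‖x‖ ≤ ‖codingDiff hn v w i x‖ := by
  have key : ∀ i, (i = v 0 ∨ i = w 0) → tailWeight c v i + tailWeight c w i ≤ c / (1 - c) →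
      ∀ x, (1 - c / (1 - c)) * ‖x‖ ≤ ‖codingDiff hn v w i x‖ := by
    intro i hi hle x
    have hv := norm_coding_single_sub_le hn hc0 hc hcT v i x
    have hw := norm_coding_single_sub_le hn hc0 hc hcT w i x
    -- Exactly one of the first letters equals `i`, so the leading part is `x` or `-x`.
    have h1 : ‖(if v 0 = i then x else 0) - (if w 0 = i then x else 0)‖ = ‖x‖ := by
      rcases hi with rfl | rfl
      · simp [hvw.symm]
      · simp [hvw]
    have h2 : codingDiff hn v w i x = ((if v 0 = i then x else 0) - (if w 0 = i then x else 0)) +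
        ((coding T (Pi.single i x) v - (if v 0 = i then x else 0)) -
          (coding T (Pi.single i x) w - (if w 0 = i then x else 0))) := by
      rw [codingDiff_apply]; abel
    have h3 := norm_sub_le (coding T (Pi.single i x) v - (if v 0 = i then x else 0))
      (coding T (Pi.single i x) w - (if w 0 = i then x else 0))
    have h4 := norm_sub_le_norm_add ((if v 0 = i then x else 0) - (if w 0 = i then x else 0))
      ((coding T (Pi.single i x) v - (if v 0 = i then x else 0)) -
          (coding T (Pi.single i x) w - (if w 0 = i then x else 0)))
    rw [← h2, h1] at h4
    have h5 := mul_le_mul_of_nonneg_right hle (norm_nonneg x)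
    linarith
  -- Over the letters `v 0` and `w 0` the tail weights of `v` and `w` total at most `2c/(1-c)`, so
  -- one of these letters has at most `c/(1-c)`. This is below 1 precisely when `c < 1/2`.
  have hv := tailWeight_add_le hc0 hc v hvw
  have hw := tailWeight_add_le hc0 hc w hvw
  rcases le_total (tailWeight c v (v 0) + tailWeight c w (v 0))
    (tailWeight c v (w 0) + tailWeight c w (w 0)) with h | h
  · exact ⟨v 0, key _ (Or.inl rfl) (by linarith)⟩
  · exact ⟨w 0, key _ (Or.inr rfl) (by linarith)⟩

/-- Fubini with the block `a_i` as inner variable; the remaining blocks stay in a ball of radius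
`ρ`. -/
theorem volume_le_of_update {m : ℕ} (i : Fin (m + 1)) {S : Set (Fin (m + 1) → E d)}
    (hS : MeasurableSet S) {ρ : ℝ} (hρ : 0 ≤ ρ) (hSρ : ∀ a ∈ S, ‖a‖ ≤ ρ) {c : ℝ≥0∞}
    (h : ∀ a, volume {x : E d | Function.update a i x ∈ S} ≤ c) :
    volume S ≤ c * volume (Metric.closedBall (0 : Fin m → E d) ρ) := by
  have hmp := (volume_preserving_piFinSuccAbove (fun _ : Fin (m + 1) => E d) i).symm
  rw [← hmp.measure_preimage hS.nullMeasurableSet]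
  refine (Measure.prod_apply_symm (hmp.measurable hS)).trans_le ?_
  rw [← setLIntegral_const, ← lintegral_indicator Metric.isClosed_closedBall.measurableSet]
  refine lintegral_mono fun y => ?_
  have hsec : ∀ x : E d, (MeasurableEquiv.piFinSuccAbove (fun _ => E d) i).symm (x, y) =
      Function.update (i.insertNth (0 : E d) y : Fin (m + 1) → E d) i x := by
    intro x
    rw [MeasurableEquiv.piFinSuccAbove_symm_apply, Fin.update_insertNth]
    rfl
  by_cases hy : y ∈ Metric.closedBall (0 : Fin m → E d) ρ
  · rw [indicator_of_mem hy]
    refine le_trans (le_of_eq ?_) (h (i.insertNth (0 : E d) y))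
    congr 1
    ext x
    simp only [mem_preimage, hsec]
    rfl
  · rw [indicator_of_notMem hy, nonpos_iff_eq_zero]
    convert measure_empty (μ := (volume : Measure (E d)))
    ext x
    simp only [mem_preimage, hsec, mem_empty_iff_false, iff_false]
    intro hx
    refine hy (mem_closedBall_zero_iff.2 ((pi_norm_le_iff_of_nonneg hρ).2 fun j => ?_))
    have h1 := (norm_le_pi_norm _ (i.succAbove j)).trans (hSρ _ hx)
    simpa [Fin.succAbove_ne] using h1

/-- The transversality estimate. -/
theorem exists_volume_coding_sub_le (hd : 1 ≤ d) (hM : 1 ≤ M) (hT : ∀ j, (T j).det ≠ 0)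
    (hn : ∀ j, ‖T j‖ < 1 / 2) {s ρ : ℝ} (hs : 0 ≤ s) (hsd : s ≤ d) (hρ : 1 ≤ ρ) :
    ∃ C : ℝ≥0∞, C ≠ ∞ ∧ C ≠ 0 ∧ ∀ (v w : ℕ → Fin M) (n : ℕ), (∀ i < n, v i = w i) → v n ≠ w n →
      ∀ r : ℝ, 0 < r → volume {a : Fin M → E d | ‖a‖ ≤ ρ ∧ ‖coding T a v - coding T a w‖ ≤ r} ≤
        C * ENNReal.ofReal (r ^ s) / ENNReal.ofReal (svf s (wordMap T (initWord v n))) := by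
  -- The supremum norm of the family is a common contraction bound, still below 1/2 because the
  -- family is finite.
  have hc : ‖T‖ < 1 / 2 := (pi_norm_lt_iff (by norm_num)).2 hn
  have hcT : ∀ j, ‖T j‖ ≤ ‖T‖ := norm_le_pi_norm T
  set κ := 1 - ‖T‖ / (1 - ‖T‖) with hκ
  have hκpos : 0 < κ := by
    rw [hκ, sub_pos, div_lt_one (by linarith)]
    linarith
  obtain ⟨m, rfl⟩ : ∃ m, M = m + 1 := ⟨M - 1, by omega⟩
  refine ⟨ENNReal.ofReal ((4 * ρ) ^ d * 2 ^ s * κ⁻¹ ^ s) *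
    volume (Metric.closedBall (0 : Fin m → E d) ρ),
    ENNReal.mul_ne_top ENNReal.ofReal_ne_top measure_closedBall_lt_top.ne, ?_, ?_⟩
  · refine mul_ne_zero ?_ (Metric.measure_closedBall_pos _ _ (by linarith)).ne'
    rw [Ne, ENNReal.ofReal_eq_zero, not_le]
    have : 0 < ρ := by linarith
    positivity
  intro v w n hvw hne r hr
  obtain ⟨i, hi⟩ := exists_le_norm_codingDiff hn (norm_nonneg T) (by linarith) hcT
    (v := fun k => v (k + n)) (w := fun k => w (k + n)) (by simpa using hne)
  have hmeas : MeasurableSet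
      {a : Fin (m + 1) → E d | ‖a‖ ≤ ρ ∧ ‖coding T a v - coding T a w‖ ≤ r} := by
    have h1 : ∀ v, Continuous fun a : Fin (m + 1) → E d => coding T a v := fun v =>
      (continuous_coding hn).comp (continuous_id.prodMk continuous_const)
    exact ((isClosed_le continuous_norm continuous_const).inter
      (isClosed_le ((h1 v).sub (h1 w)).norm continuous_const)).measurableSet
  have hdet := det_wordMap_ne_zero hT (initWord v n)
  refine (volume_le_of_update i hmeas (by linarith) (fun a ha => ha.1)
    (c := ENNReal.ofReal ((4 * ρ) ^ d * 2 ^ s * κ⁻¹ ^ s *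
      (r ^ s / svf s (wordMap T (initWord v n))))) fun a => ?_).trans_eq ?_
  · refine le_trans (measure_mono ?_) (volume_norm_apply_add_le hd hdet hs hsd hκpos hi hρ hr
      (coding T (Function.update a i 0) (fun k => v (k + n)) -
        coding T (Function.update a i 0) fun k => w (k + n)))
    rintro x ⟨hx1, hx2⟩
    refine ⟨?_, ?_⟩
    · simpa using (norm_le_pi_norm _ i).trans hx1
    · rwa [coding_sub_coding hn _ n hvw, coding_update_sub hn] at hx2
  · rw [ENNReal.ofReal_mul (by positivity), ENNReal.ofReal_div_of_pos (svf_pos hdet hs)]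
    simp only [div_eq_mul_inv]
    ring

end Transversality

/-! ### Energy criteria for dimension and for positive volume -/

section MassDistribution

variable {d : ℕ}

theorem measurable_measure_closedBall (ν : Measure (E d)) [SFinite ν] (r : ℝ) :
    Measurable fun x => ν (Metric.closedBall x r) := by
  have h : MeasurableSet {p : E d × E d | dist p.2 p.1 ≤ r} :=
    (isClosed_le (continuous_snd.dist continuous_fst) continuous_const).measurableSet
  exact measurable_measure_prodMk_left h

/-- Finite energy forces large Hausdorff dimension. -/
theorem le_dimH_of_tsum_lintegral_closedBall_ne_top {ν : Measure (E d)} [IsProbabilityMeasure ν]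
    {F : Set (E d)} (hF : MeasurableSet F) (hνF : ν Fᶜ = 0) {t : ℝ} (ht : 0 < t)
    (h : ∑' n : ℕ, (ENNReal.ofReal (((1 / 2 : ℝ) ^ n) ^ t))⁻¹ *
      ∫⁻ x, ν (Metric.closedBall x ((1 / 2 : ℝ) ^ n)) ∂ν ≠ ∞) :
    ENNReal.ofReal t ≤ dimH F := by
  let W : ℕ → ℝ≥0∞ := fun n => ENNReal.ofReal (((1 / 2 : ℝ) ^ n) ^ t)
  have hW0 : ∀ n, W n ≠ 0 := fun n => by
    simp only [W, Ne, ENNReal.ofReal_eq_zero, not_le]; positivity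
  have hWt : ∀ n, W n ≠ ∞ := fun n => ENNReal.ofReal_ne_top
  let f : E d → ℝ≥0∞ := fun x => ∑' n : ℕ, (W n)⁻¹ * ν (Metric.closedBall x ((1 / 2 : ℝ) ^ n))
  have hfn : ∀ n, Measurable fun x => (W n)⁻¹ * ν (Metric.closedBall x ((1 / 2 : ℝ) ^ n)) :=
    fun n => (measurable_measure_closedBall ν _).const_mul _
  have hf : Measurable f := Measurable.tsum hfn
  have hint : ∫⁻ x, f x ∂ν ≠ ∞ := by
    rw [lintegral_tsum fun n => (hfn n).aemeasurable]
    simp only [lintegral_const_mul _ (measurable_measure_closedBall ν _)]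
    exact h
  -- The potential `f` is finite almost everywhere, so some sublevel set has positive mass. On it
  -- every dyadic ball has mass at most `(N + 1) 2^{-nt}`.
  obtain ⟨N, hN⟩ : ∃ N : ℕ, ν ({x | f x ≤ N} ∩ F) ≠ 0 := by
    by_contra! hcon
    have h1 : ν (⋃ N : ℕ, {x | f x ≤ N} ∩ F) = 0 := measure_iUnion_null hcon
    have h2 : ∀ᵐ x ∂ν, f x < ∞ := ae_lt_top hf hint
    have h3 : ∀ᵐ x ∂ν, x ∈ F := hνF
    have h4 : ∀ᵐ x ∂ν, x ∉ ⋃ N : ℕ, {x | f x ≤ N} ∩ F := measure_eq_zero_iff_ae_notMem.1 h1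
    obtain ⟨x, hx2, hx3, hx4⟩ := (h2.and (h3.and h4)).exists
    obtain ⟨n, hn⟩ := ENNReal.exists_nat_gt hx2.ne
    exact hx4 (mem_iUnion.2 ⟨n, hn.le, hx3⟩)
  set A := {x | f x ≤ N} ∩ F with hA
  have hAm : MeasurableSet A := (measurableSet_le hf measurable_const).inter hF
  have hball : ∀ x ∈ A, ∀ n, ν (Metric.closedBall x ((1 / 2 : ℝ) ^ n)) ≤ (N + 1) * W n := by
    intro x hx n
    have h1 : (W n)⁻¹ * ν (Metric.closedBall x ((1 / 2 : ℝ) ^ n)) ≤ N + 1 :=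
      ((ENNReal.le_tsum n).trans hx.1).trans le_self_add
    rw [mul_comm, ← div_eq_mul_inv] at h1
    exact (ENNReal.div_le_iff (hW0 n) (hWt n)).1 h1
  set L : ℝ≥0∞ := (N + 1) * ENNReal.ofReal (2 ^ t) with hL
  have h2t : ENNReal.ofReal ((2 : ℝ) ^ t) ≠ 0 := by
    rw [Ne, ENNReal.ofReal_eq_zero, not_le]; positivity
  have hL0 : L ≠ 0 := mul_ne_zero (by simp) h2t
  have hLt : L ≠ ∞ := ENNReal.mul_ne_top (by simp) ENNReal.ofReal_ne_top
  have hle : L⁻¹ • ν.restrict A ≤ μH[t] := by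
    refine Measure.le_hausdorffMeasure t _ 1 one_pos fun U hU => ?_
    rw [Measure.smul_apply, smul_eq_mul, Measure.restrict_apply' hAm]
    rcases eq_empty_or_nonempty (U ∩ A) with he | ⟨x, hxU, hxA⟩
    · simp [he]
    have hUt : Metric.ediam U ≠ ∞ := (hU.trans_lt ENNReal.one_lt_top).ne
    -- A set of diameter 0 has no matching dyadic scale; it lies in balls of all scales, hence is
    -- null.
    rcases eq_or_ne (Metric.ediam U) 0 with h0 | h0
    · have hz : ν (U ∩ A) = 0 := by
        have h1 : Tendsto (fun n => (N + 1 : ℝ≥0∞) * W n) atTop (𝓝 0) := by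
          have h2 : Tendsto (fun n : ℕ => ((1 / 2 : ℝ) ^ n) ^ t) atTop (𝓝 0) := by
            have h3 := (tendsto_pow_atTop_nhds_zero_of_lt_one (r := (1 / 2 : ℝ)) (by norm_num)
              (by norm_num)).rpow_const (Or.inr ht.le)
            rwa [Real.zero_rpow ht.ne'] at h3
          have h4 := ENNReal.Tendsto.const_mul (a := (N + 1 : ℝ≥0∞)) (ENNReal.tendsto_ofReal h2)
            (Or.inr (by simp))
          rwa [ENNReal.ofReal_zero, mul_zero] at h4
        refine le_antisymm (ge_of_tendsto' h1 fun n => ?_) bot_le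
        refine (measure_mono fun y hy => ?_).trans (hball x hxA n)
        rw [Metric.mem_closedBall, ← edist_le_ofReal (by positivity)]
        exact (Metric.edist_le_ediam_of_mem hy.1 hxU).trans (by rw [h0]; exact bot_le)
      rw [hz, mul_zero]
      exact bot_le
    · have hδ : 0 < (Metric.ediam U).toReal := ENNReal.toReal_pos h0 hUt
      have hδ1 : (Metric.ediam U).toReal ≤ 1 := by
        simpa using ENNReal.toReal_mono ENNReal.one_ne_top hU
      -- Choose `2^{-(n+1)} < diam U ≤ 2^{-n}`; the loss of one dyadic step is the factor `2^t` in
      -- `L`.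
      obtain ⟨n, hn1, hn2⟩ := exists_nat_pow_near_of_lt_one hδ hδ1 (y := (1 / 2 : ℝ))
        (by norm_num) (by norm_num)
      have h1 : ν (U ∩ A) ≤ (N + 1) * W n := by
        refine (measure_mono fun y hy => ?_).trans (hball x hxA n)
        rw [Metric.mem_closedBall, ← edist_le_ofReal (by positivity)]
        refine (Metric.edist_le_ediam_of_mem hy.1 hxU).trans ?_
        rw [← ENNReal.ofReal_toReal hUt]
        exact ENNReal.ofReal_le_ofReal hn2
      have h2 : W n ≤ ENNReal.ofReal (2 ^ t) * Metric.ediam U ^ t := by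
        rw [← ENNReal.ofReal_toReal hUt, ENNReal.ofReal_rpow_of_pos hδ,
          ← ENNReal.ofReal_mul (by positivity), ← Real.mul_rpow zero_le_two hδ.le]
        refine ENNReal.ofReal_le_ofReal (Real.rpow_le_rpow (by positivity) ?_ ht.le)
        rw [pow_succ] at hn1
        linarith
      rw [mul_comm, ← div_eq_mul_inv, ENNReal.div_le_iff hL0 hLt]
      refine h1.trans ((mul_le_mul_right h2 _).trans_eq ?_)
      rw [hL]; ring
  have hpos : μH[t] F ≠ 0 := by
    intro h0
    have h1 := hle F
    rw [h0, Measure.smul_apply, Measure.restrict_apply' hAm, smul_eq_mul] at h1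
    have h2 : F ∩ A = A := inter_eq_right.2 inter_subset_right
    rw [h2] at h1
    exact (mul_ne_zero (ENNReal.inv_ne_zero.2 hLt) hN) (le_antisymm h1 bot_le)
  rw [ENNReal.ofReal]
  refine le_dimH_of_hausdorffMeasure_ne_zero ?_
  rwa [Real.coe_toNNReal _ ht.le]

/-- Tonelli, since `y ∈ B(x, r)` is symmetric in `x` and `y`. -/
theorem lintegral_setLIntegral_closedBall (ν : Measure (E d)) [SFinite ν] (r : ℝ)
    {k : E d → ℝ≥0∞} (hk : Measurable k) :
    ∫⁻ x, ∫⁻ y in Metric.closedBall x r, k y ∂ν =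
      ∫⁻ y, volume (Metric.closedBall y r) * k y ∂ν := by
  have hm : MeasurableSet {p : E d × E d | dist p.2 p.1 ≤ r} :=
    (isClosed_le (continuous_snd.dist continuous_fst) continuous_const).measurableSet
  have h1 : ∀ x, ∫⁻ y in Metric.closedBall x r, k y ∂ν =
      ∫⁻ y, {p : E d × E d | dist p.2 p.1 ≤ r}.indicator (fun p => k p.2) (x, y) ∂ν := by
    intro x
    rw [← lintegral_indicator Metric.isClosed_closedBall.measurableSet]
    rfl
  simp only [h1]
  have hswap : AEMeasurable (Function.uncurry fun x y =>
      {p : E d × E d | dist p.2 p.1 ≤ r}.indicator (fun p => k p.2) (x, y))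
      ((volume : Measure (E d)).prod ν) :=
    ((hk.comp measurable_snd).indicator hm).aemeasurable
  rw [lintegral_lintegral_swap hswap]
  refine lintegral_congr fun y => ?_
  have h2 : ∀ x, {p : E d × E d | dist p.2 p.1 ≤ r}.indicator (fun p => k p.2) (x, y) =
      (Metric.closedBall y r).indicator (fun _ => k y) x := by
    intro x
    simp only [indicator, mem_ofPred_eq, Metric.mem_closedBall, dist_comm y x]
  simp only [h2]
  rw [lintegral_indicator Metric.isClosed_closedBall.measurableSet, setLIntegral_const, mul_comm]

/-- A lower bound for the volume of a neighbourhood of a set carrying `ν`. -/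
theorem volume_closedBall_le_mul_lintegral {ν : Measure (E d)} [IsProbabilityMeasure ν]
    {F : Set (E d)} (hνF : ν Fᶜ = 0) {r : ℝ} (hr : 0 < r) :
    volume (Metric.closedBall (0 : E d) r) ≤ volume (Metric.cthickening r F) *
      ∫⁻ y, ν (Metric.closedBall y (2 * r)) ∂ν := by
  set ω := volume (Metric.closedBall (0 : E d) r) with hω
  have hω0 : ω ≠ 0 := (Metric.measure_closedBall_pos _ _ hr).ne'
  have hωt : ω ≠ ∞ := measure_closedBall_lt_top.ne
  have hωy : ∀ y : E d, volume (Metric.closedBall y r) = ω := fun y => by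
    rw [hω, Measure.addHaar_closedBall_center]
  set g : E d → ℝ≥0∞ := fun x => ν (Metric.closedBall x r) with hg
  have hgm : Measurable g := measurable_measure_closedBall ν r
  set V := Metric.cthickening r F with hV
  have hVm : MeasurableSet V := Metric.isClosed_cthickening.measurableSet
  have hG : ∫⁻ x, g x = ω := by
    have h1 := lintegral_setLIntegral_closedBall ν r (k := fun _ => 1) measurable_const
    simp only [one_mul, mul_one, hωy, lintegral_const, measure_univ, Measure.restrict_apply_univ] at h1
    exact h1
  -- Write `g(x)²` as the integral of the constant `g(x)` over `B(x, r)` and use `B(x, r) ⊆ B(y,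
  -- 2r)` for `y` in that ball.
  have hQ : ∫⁻ x, g x ^ (2 : ℝ) ≤ ω * ∫⁻ y, ν (Metric.closedBall y (2 * r)) ∂ν := by
    have hm := measurable_measure_closedBall ν (2 * r)
    have h1 := lintegral_setLIntegral_closedBall ν r hm
    simp only [hωy] at h1
    rw [← lintegral_const_mul _ hm, ← h1]
    refine lintegral_mono fun x => ?_
    have h2 : g x ^ (2 : ℝ) = ∫⁻ _y in Metric.closedBall x r, g x ∂ν := by
      rw [setLIntegral_const, ENNReal.rpow_two, sq]
    rw [h2]
    refine setLIntegral_mono hm fun y hy => measure_mono ?_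
    refine Metric.closedBall_subset_closedBall' ?_
    rw [dist_comm]
    have := Metric.mem_closedBall.1 hy
    linarith
  have hsupp : ∀ x, g x = (g * (V.indicator 1 : E d → ℝ≥0∞)) x := by
    intro x
    by_cases hx : x ∈ V
    · simp [hx]
    · rw [Pi.mul_apply, indicator_of_notMem hx, mul_zero]
      have hsub : Metric.closedBall x r ⊆ Fᶜ := fun y hy hyF =>
        hx (Metric.mem_cthickening_of_dist_le x y r F hyF
          (by rw [dist_comm]; exact Metric.mem_closedBall.1 hy))
      exact measure_mono_null hsub hνF
  -- Cauchy–Schwarz for `g` and the indicator of the neighbourhood `V`, outside which `g` vanishes.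
  have hCS := ENNReal.lintegral_mul_le_Lp_mul_Lq volume Real.HolderConjugate.two_two
    hgm.aemeasurable ((measurable_one.indicator hVm).aemeasurable (μ := (volume : Measure (E d))))
  rw [← lintegral_congr hsupp, hG] at hCS
  have hind : ∫⁻ x : E d, (V.indicator 1 x : ℝ≥0∞) ^ (2 : ℝ) = volume V := by
    rw [← lintegral_indicator_one hVm]
    refine lintegral_congr fun x => ?_
    by_cases hx : x ∈ V <;> simp [hx]
  rw [hind] at hCS
  have h3 : ω * ω ≤ ω * (volume V * ∫⁻ y, ν (Metric.closedBall y (2 * r)) ∂ν) := by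
    calc ω * ω ≤ ((∫⁻ x, g x ^ (2 : ℝ)) ^ (1 / 2 : ℝ) * volume V ^ (1 / 2 : ℝ)) *
          ((∫⁻ x, g x ^ (2 : ℝ)) ^ (1 / 2 : ℝ) * volume V ^ (1 / 2 : ℝ)) := mul_le_mul' hCS hCS
      _ = (∫⁻ x, g x ^ (2 : ℝ)) * volume V := by
          rw [mul_mul_mul_comm, ← ENNReal.rpow_add_of_nonneg _ _ (by norm_num) (by norm_num),
            ← ENNReal.rpow_add_of_nonneg _ _ (by norm_num) (by norm_num)]
          norm_num
      _ ≤ (ω * ∫⁻ y, ν (Metric.closedBall y (2 * r)) ∂ν) * volume V := mul_le_mul_left hQ _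
      _ = _ := by ring
  exact (ENNReal.mul_le_mul_iff_right hω0 hωt).1 h3

/-- If `F` were null, the volumes of its closed neighbourhoods would tend to 0 by compactness; yet
along infinitely many scales the preceding inequality bounds them below by a fixed positive number.
-/
theorem volume_pos_of_liminf_lintegral_closedBall_lt_top {ν : Measure (E d)}
    [IsProbabilityMeasure ν] {F : Set (E d)} (hF : IsCompact F) (hνF : ν Fᶜ = 0)
    (h : liminf (fun n : ℕ => (ENNReal.ofReal (((1 / 2 : ℝ) ^ n) ^ (d : ℝ)))⁻¹ *
      ∫⁻ x, ν (Metric.closedBall x ((1 / 2 : ℝ) ^ n)) ∂ν) atTop < ∞) :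
    0 < volume F := by
  refine pos_iff_ne_zero.2 fun h0 => ?_
  obtain ⟨K, hK, hKt⟩ := exists_between h
  have hfreq := frequently_lt_of_liminf_lt (by isBoundedDefault) hK
  set ω := volume (Metric.ball (0 : E d) 1) with hω
  have hω0 : ω ≠ 0 := (Metric.measure_ball_pos _ _ one_pos).ne'
  have hlim : Tendsto (fun n : ℕ => volume (Metric.cthickening ((1 / 2 : ℝ) ^ (n + 1)) F) * K)
      atTop (𝓝 0) := by
    have h1 := (tendsto_measure_cthickening_of_isCompact (μ := volume) hF).comp
      ((tendsto_pow_atTop_nhds_zero_of_lt_one (r := (1 / 2 : ℝ)) (by norm_num)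
        (by norm_num)).comp (tendsto_add_atTop_nat 1))
    rw [h0] at h1
    have h2 := ENNReal.Tendsto.mul_const h1 (b := K) (Or.inr hKt.ne)
    simpa [Function.comp_def] using h2
  have hc : 0 < ENNReal.ofReal ((1 / 2 : ℝ) ^ d) * ω := by
    refine pos_iff_ne_zero.2 (mul_ne_zero ?_ hω0)
    rw [Ne, ENNReal.ofReal_eq_zero, not_le]
    positivity
  obtain ⟨n, hn1, hn2⟩ := (hfreq.and_eventually (hlim.eventually_lt_const hc)).exists
  refine hn2.not_ge ?_
  have h1 := volume_closedBall_le_mul_lintegral hνF (r := (1 / 2 : ℝ) ^ (n + 1)) (by positivity)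
  rw [show 2 * (1 / 2 : ℝ) ^ (n + 1) = (1 / 2) ^ n by rw [pow_succ]; ring] at h1
  rw [Measure.addHaar_closedBall _ _ (by positivity), finrank_euclideanSpace_fin, ← hω] at h1
  set D := ∫⁻ x, ν (Metric.closedBall x ((1 / 2 : ℝ) ^ n)) ∂ν with hD
  set w := ENNReal.ofReal (((1 / 2 : ℝ) ^ n) ^ (d : ℝ)) with hw
  have hw0 : w ≠ 0 := by
    rw [hw, Ne, ENNReal.ofReal_eq_zero, not_le]; positivity
  have hwt : w ≠ ∞ := ENNReal.ofReal_ne_top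
  have hDK : D ≤ K * w := by
    rw [mul_comm, ← div_eq_mul_inv] at hn1
    exact (ENNReal.div_le_iff hw0 hwt).1 hn1.le
  have h2 : ENNReal.ofReal (((1 / 2 : ℝ) ^ (n + 1)) ^ d) = w * ENNReal.ofReal ((1 / 2 : ℝ) ^ d) := by
    rw [hw, ← ENNReal.ofReal_mul (by positivity), Real.rpow_natCast, pow_succ, mul_pow]
  rw [h2] at h1
  have h3 : w * (ENNReal.ofReal ((1 / 2 : ℝ) ^ d) * ω) ≤
      w * (volume (Metric.cthickening ((1 / 2 : ℝ) ^ (n + 1)) F) * K) := by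
    calc _ = w * ENNReal.ofReal ((1 / 2 : ℝ) ^ d) * ω := by ring
      _ ≤ volume (Metric.cthickening ((1 / 2 : ℝ) ^ (n + 1)) F) * (K * w) :=
        h1.trans (mul_le_mul_right hDK _)
      _ = _ := by ring
  exact (ENNReal.mul_le_mul_iff_right hw0 hwt).1 h3

end MassDistribution

/-! ### Average energy and the almost sure statements -/

section Energy

variable {d M : ℕ} {T : Fin M → (E d →L[ℝ] E d)}

theorem measurable_comp_initWord (f : List (Fin M) → ℝ≥0∞) (n : ℕ) :
    Measurable fun v : ℕ → Fin M => f (initWord v n) := by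
  have h : Measurable fun u : Fin n → Fin M => f (List.ofFn u) := measurable_of_finite _
  exact h.comp (measurable_pi_lambda _ fun i => measurable_pi_apply _)

theorem measurableSet_agree (n : ℕ) :
    MeasurableSet {p : (ℕ → Fin M) × (ℕ → Fin M) | ∀ i < n, p.1 i = p.2 i} := by
  have h : {p : (ℕ → Fin M) × (ℕ → Fin M) | ∀ i < n, p.1 i = p.2 i} =
      ⋂ i : Fin n, {p | p.1 i = p.2 i} := by
    ext p
    simp [Fin.forall_iff]
  rw [h]
  exact MeasurableSet.iInter fun i => (isClosed_eq ((continuous_apply _).comp continuous_fst)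
    ((continuous_apply _).comp continuous_snd)).measurableSet

/-- The energy of a Frostman measure with respect to a smaller exponent is finite. -/
theorem tsum_lintegral_indicator_ne_top (hd : 1 ≤ d) (hT : ∀ j, (T j).det ≠ 0)
    (hn : ∀ j, ‖T j‖ < 1 / 2) {s t : ℝ} (ht : 0 ≤ t) (hts : t < s)
    {μ : Measure (ℕ → Fin M)} [IsProbabilityMeasure μ] {K : ℝ≥0∞} (hK : K ≠ ∞)
    (hμ : ∀ u, μ (cylinder u) ≤ K * ENNReal.ofReal (svf s (wordMap T u))) :
    ∫⁻ p, ∑' n : ℕ, {p : (ℕ → Fin M) × (ℕ → Fin M) | ∀ i < n, p.1 i = p.2 i}.indicator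
      (fun p => (ENNReal.ofReal (svf t (wordMap T (initWord p.1 n))))⁻¹) p ∂μ.prod μ ≠ ∞ := by
  set q : ℝ := (1 / 2 : ℝ) ^ (s - t) with hq
  have hq0 : 0 ≤ q := by positivity
  have hq1 : q < 1 := Real.rpow_lt_one (by norm_num) (by norm_num) (sub_pos.2 hts)
  let H : ℕ → (ℕ → Fin M) → ℝ≥0∞ := fun n v =>
    (ENNReal.ofReal (svf t (wordMap T (initWord v n))))⁻¹
  have hH : ∀ n, Measurable (H n) := fun n =>
    measurable_comp_initWord (fun u => (ENNReal.ofReal (svf t (wordMap T u)))⁻¹) n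
  have hmeas : ∀ n, Measurable fun p : (ℕ → Fin M) × (ℕ → Fin M) =>
      {p : (ℕ → Fin M) × (ℕ → Fin M) | ∀ i < n, p.1 i = p.2 i}.indicator
        (fun p => H n p.1) p := fun n =>
    ((hH n).comp measurable_fst).indicator (measurableSet_agree n)
  have hbound : ∀ n, ∫⁻ p, {p : (ℕ → Fin M) × (ℕ → Fin M) | ∀ i < n, p.1 i = p.2 i}.indicator
      (fun p => H n p.1) p ∂μ.prod μ ≤ K * ENNReal.ofReal q ^ n := by
    intro n
    rw [lintegral_prod _ (hmeas n).aemeasurable]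
    have h1 : ∀ v, ∫⁻ w, {p : (ℕ → Fin M) × (ℕ → Fin M) | ∀ i < n, p.1 i = p.2 i}.indicator
        (fun p => H n p.1) (v, w) ∂μ ≤ K * ENNReal.ofReal q ^ n := by
      intro v
      have h2 : ∀ w, {p : (ℕ → Fin M) × (ℕ → Fin M) | ∀ i < n, p.1 i = p.2 i}.indicator
          (fun p => H n p.1) (v, w) = (cylinder (initWord v n)).indicator (fun _ => H n v) w := by
        intro w
        simp only [indicator, mem_ofPred_eq, mem_cylinder_initWord_iff, eq_comm]
      simp only [h2]
      rw [lintegral_indicator (isClopen_cylinder _).isOpen.measurableSet, setLIntegral_const]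
      have hpos := svf_pos (det_wordMap_ne_zero hT (initWord v n)) ht
      -- The gap `s - t` gives the geometric factor `q^n`, which makes the sum over `n` converge.
      have h3 : μ (cylinder (initWord v n)) ≤ K * ENNReal.ofReal q ^ n *
          ENNReal.ofReal (svf t (wordMap T (initWord v n))) := by
        refine (hμ _).trans ?_
        rw [mul_assoc, ← ENNReal.ofReal_pow hq0, ← ENNReal.ofReal_mul (pow_nonneg hq0 n)]
        refine mul_le_mul_right (ENNReal.ofReal_le_ofReal ?_) K
        have := svf_wordMap_le hd hT hn ht hts.le (initWord v n)
        rwa [length_initWord, mul_comm] at this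
      rw [mul_comm, ← div_eq_mul_inv]
      exact ENNReal.div_le_of_le_mul h3
    refine (lintegral_mono h1).trans_eq ?_
    simp
  rw [lintegral_tsum fun n => (hmeas n).aemeasurable]
  refine ne_top_of_le_ne_top ?_ (ENNReal.tsum_le_tsum hbound)
  rw [ENNReal.tsum_mul_left, ENNReal.tsum_geometric]
  refine ENNReal.mul_ne_top hK (ENNReal.inv_ne_top.2 ?_)
  rw [Ne, tsub_eq_zero_iff_le, not_le, ← ENNReal.ofReal_one, ENNReal.ofReal_lt_ofReal_iff one_pos]
  exact hq1

/-- The pairs of words whose images under the coding map are `r`-close. -/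
def closePairs (T : Fin M → (E d →L[ℝ] E d)) (a : Fin M → E d) (r : ℝ) :
    Set ((ℕ → Fin M) × (ℕ → Fin M)) :=
  {p | ‖coding T a p.1 - coding T a p.2‖ ≤ r}

theorem measurableSet_closePairs_prod (hn : ∀ j, ‖T j‖ < 1 / 2) (r : ℝ) :
    MeasurableSet {x : (Fin M → E d) × ((ℕ → Fin M) × (ℕ → Fin M)) |
      x.2 ∈ closePairs T x.1 r} := by
  have h1 : Continuous fun x : (Fin M → E d) × ((ℕ → Fin M) × (ℕ → Fin M)) =>
      coding T x.1 x.2.1 :=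
    (continuous_coding hn).comp (continuous_fst.prodMk (continuous_fst.comp continuous_snd))
  have h2 : Continuous fun x : (Fin M → E d) × ((ℕ → Fin M) × (ℕ → Fin M)) =>
      coding T x.1 x.2.2 :=
    (continuous_coding hn).comp (continuous_fst.prodMk (continuous_snd.comp continuous_snd))
  exact (isClosed_le (h1.sub h2).norm continuous_const).measurableSet

theorem measurable_measure_closePairs (hn : ∀ j, ‖T j‖ < 1 / 2)
    (m : Measure ((ℕ → Fin M) × (ℕ → Fin M))) [SFinite m] (r : ℝ) :
    Measurable fun a => m (closePairs T a r) :=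
  measurable_measure_prodMk_left (measurableSet_closePairs_prod hn r)

/-- Tonelli exchanges `a` with the pair of words; for each pair the transversality estimate applies
at the first disagreement. -/
theorem exists_setLIntegral_closePairs_le (hd : 1 ≤ d) (hM : 1 ≤ M) (hT : ∀ j, (T j).det ≠ 0)
    (hn : ∀ j, ‖T j‖ < 1 / 2) {s t ρ : ℝ} (ht : 0 ≤ t) (htd : t ≤ d) (hts : t < s) (hρ : 1 ≤ ρ)
    {μ : Measure (ℕ → Fin M)} [IsProbabilityMeasure μ] {K : ℝ≥0∞} (hK : K ≠ ∞)
    (hμ : ∀ u, μ (cylinder u) ≤ K * ENNReal.ofReal (svf s (wordMap T u))) :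
    ∃ C : ℝ≥0∞, C ≠ ∞ ∧ ∀ r : ℝ, 0 < r →
      ∫⁻ a in Metric.closedBall (0 : Fin M → E d) ρ, μ.prod μ (closePairs T a r) ≤
        C * ENNReal.ofReal (r ^ t) := by
  obtain ⟨C, hCt, hC0, hC⟩ := exists_volume_coding_sub_le hd hM hT hn ht htd hρ
  refine ⟨C * _, ENNReal.mul_ne_top hCt (tsum_lintegral_indicator_ne_top hd hT hn ht hts hK hμ),
    fun r hr => ?_⟩
  have hms := measurableSet_closePairs_prod (T := T) hn r
  have h1 := (Measure.prod_apply
    (μ := (volume : Measure (Fin M → E d)).restrict (Metric.closedBall 0 ρ))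
    (ν := μ.prod μ) hms).symm.trans (Measure.prod_apply_symm hms)
  refine h1.trans_le ?_
  rw [mul_right_comm, ← lintegral_const_mul' _ _ (ENNReal.mul_ne_top hCt ENNReal.ofReal_ne_top)]
  refine lintegral_mono fun p => ?_
  rw [← ENNReal.tsum_mul_left, Measure.restrict_apply' Metric.isClosed_closedBall.measurableSet]
  by_cases hp : p.1 = p.2
  -- On the diagonal the words agree at every `n`, so the right side is a sum of infinitely many
  -- terms at least `C r^t > 0`. This is where `C ≠ 0` is needed.
  · have hr' : 0 < r ^ t := Real.rpow_pos_of_pos hr t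
    have h2 : C * ENNReal.ofReal (r ^ t) ≠ 0 :=
      mul_ne_zero hC0 (by rw [Ne, ENNReal.ofReal_eq_zero, not_le]; exact hr')
    refine le_trans le_top ?_
    rw [← ENNReal.tsum_const_eq_top_of_ne_zero (α := ℕ) h2]
    refine ENNReal.tsum_le_tsum fun n => ?_
    have hmem : p ∈ {p : (ℕ → Fin M) × (ℕ → Fin M) | ∀ i < n, p.1 i = p.2 i} := by
      intro i _
      rw [hp]
    rw [indicator_of_mem hmem]
    refine le_mul_of_one_le_right bot_le (ENNReal.one_le_inv.2 ?_)
    refine ENNReal.ofReal_le_one.2 ((svf_wordMap_le_pow hd hT hn ht _).trans ?_)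
    exact pow_le_one₀ (by positivity) (Real.rpow_le_one (by norm_num) (by norm_num) ht)
  · have hex : ∃ n, p.1 n ≠ p.2 n := Function.ne_iff.1 hp
    classical
    have h2 := hC p.1 p.2 (Nat.find hex) (fun i hi => not_not.1 (Nat.find_min hex hi))
      (Nat.find_spec hex) r hr
    -- Of the whole sum only the term at the first disagreement is needed.
    refine le_trans (le_trans (measure_mono ?_) h2) (le_trans ?_ (ENNReal.le_tsum (Nat.find hex)))
    · rintro a ⟨ha1, ha2⟩
      exact ⟨mem_closedBall_zero_iff.1 ha2, ha1⟩
    · have hmem : p ∈ {p : (ℕ → Fin M) × (ℕ → Fin M) | ∀ i < Nat.find hex, p.1 i = p.2 i} :=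
        fun i hi => not_not.1 (Nat.find_min hex hi)
      rw [indicator_of_mem hmem, div_eq_mul_inv]

theorem ae_of_forall_closedBall {P : (Fin M → E d) → Prop}
    (h : ∀ ρ : ℝ, 1 ≤ ρ → ∀ᵐ a ∂(volume : Measure (Fin M → E d)).restrict
      (Metric.closedBall 0 ρ), P a) : ∀ᵐ a : Fin M → E d, P a := by
  have h1 : ∀ᵐ a : Fin M → E d, ∀ n : ℕ, a ∈ Metric.closedBall (0 : Fin M → E d) (n + 1) → P a :=
    ae_all_iff.2 fun n => (ae_restrict_iff' Metric.isClosed_closedBall.measurableSet).1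
      (h (n + 1) (by simp))
  filter_upwards [h1] with a ha
  obtain ⟨n, hn⟩ := exists_nat_ge ‖a‖
  exact ha n (mem_closedBall_zero_iff.2 (by linarith))

theorem lintegral_map_closedBall (hn : ∀ j, ‖T j‖ < 1 / 2) (a : Fin M → E d)
    (μ : Measure (ℕ → Fin M)) [IsProbabilityMeasure μ] (r : ℝ) :
    ∫⁻ x, μ.map (coding T a) (Metric.closedBall x r) ∂μ.map (coding T a) =
      μ.prod μ (closePairs T a r) := by
  have hc := (continuous_coding_right hn a).measurable
  have : IsProbabilityMeasure (μ.map (coding T a)) :=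
    Measure.isProbabilityMeasure_map hc.aemeasurable
  rw [lintegral_map (measurable_measure_closedBall _ r) hc, Measure.prod_apply]
  · refine lintegral_congr fun v => ?_
    rw [Measure.map_apply hc Metric.isClosed_closedBall.measurableSet]
    congr 1
    ext w
    simp only [mem_preimage, Metric.mem_closedBall, closePairs, mem_ofPred_eq, dist_eq_norm]
    rw [norm_sub_rev]
  · exact (measurable_prodMk_left (x := a)) (measurableSet_closePairs_prod hn r)

theorem map_coding_compl_range (hn : ∀ j, ‖T j‖ < 1 / 2) (a : Fin M → E d)
    (μ : Measure (ℕ → Fin M)) : μ.map (coding T a) (range (coding T a))ᶜ = 0 := by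
  have hc := continuous_coding_right hn a
  rw [Measure.map_apply hc.measurable (isCompact_range hc).isClosed.measurableSet.compl]
  convert measure_empty (μ := μ)
  ext v
  simp

/-- Three exponents `s < t < t' < s_A`: `t'` for the Frostman measure, `t` for transversality, `s`
for the dimension. The gap between `s` and `t` makes the average over `a` of the dyadic energy a
convergent geometric series. -/
theorem ae_le_dimH_range_coding (hd : 1 ≤ d) (hM : 1 ≤ M) (hT : ∀ j, (T j).det ≠ 0)
    (hn : ∀ j, ‖T j‖ < 1 / 2) (hsd : sA T ≤ d) {s : ℝ} (hs : 0 < s) (hsA : s < sA T) :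
    ∀ᵐ a : Fin M → E d, ENNReal.ofReal s ≤ dimH (range (coding T a)) := by
  obtain ⟨t', ht'1, ht'2⟩ := exists_between hsA
  obtain ⟨t, ht1, ht2⟩ := exists_between ht'1
  have ht0 : 0 < t := hs.trans ht1
  obtain ⟨μ, hμp, K, hK, hμ⟩ := exists_frostman_measure hd hM hT hn (ht0.trans ht2).le ht'2
  refine ae_of_forall_closedBall fun ρ hρ => ?_
  obtain ⟨C, hCt, hC⟩ := exists_setLIntegral_closePairs_le hd hM hT hn ht0.le
    ((ht2.trans ht'2).le.trans hsd) ht2 hρ hK hμ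
  have hmeas : ∀ n : ℕ, Measurable fun a : Fin M → E d =>
      (ENNReal.ofReal (((1 / 2 : ℝ) ^ n) ^ s))⁻¹ *
        μ.prod μ (closePairs T a ((1 / 2 : ℝ) ^ n)) := fun n =>
    (measurable_measure_closePairs hn _ _).const_mul _
  set q : ℝ := (1 / 2 : ℝ) ^ (t - s) with hq
  have hq0 : 0 ≤ q := by positivity
  have hq1 : q < 1 := Real.rpow_lt_one (by norm_num) (by norm_num) (sub_pos.2 ht1)
  have hint : ∫⁻ a in Metric.closedBall (0 : Fin M → E d) ρ, ∑' n : ℕ,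
      (ENNReal.ofReal (((1 / 2 : ℝ) ^ n) ^ s))⁻¹ *
        μ.prod μ (closePairs T a ((1 / 2 : ℝ) ^ n)) ≠ ∞ := by
    rw [lintegral_tsum fun n => (hmeas n).aemeasurable]
    have hb : ∀ n : ℕ, ∫⁻ a in Metric.closedBall (0 : Fin M → E d) ρ,
        (ENNReal.ofReal (((1 / 2 : ℝ) ^ n) ^ s))⁻¹ *
        μ.prod μ (closePairs T a ((1 / 2 : ℝ) ^ n)) ≤ C * ENNReal.ofReal q ^ n := by
      intro n
      rw [lintegral_const_mul _ (measurable_measure_closePairs hn _ _)]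
      have hr : (0 : ℝ) < (1 / 2 : ℝ) ^ n := by positivity
      refine (mul_le_mul_right (hC _ hr) _).trans_eq ?_
      rw [← ENNReal.ofReal_inv_of_pos (by positivity), mul_left_comm,
        ← ENNReal.ofReal_mul (by positivity), ← ENNReal.ofReal_pow hq0, hq,
        Real.rpow_pow_comm (by norm_num), Real.rpow_sub hr]
      congr 2
      ring
    refine ne_top_of_le_ne_top ?_ (ENNReal.tsum_le_tsum hb)
    rw [ENNReal.tsum_mul_left, ENNReal.tsum_geometric]
    refine ENNReal.mul_ne_top hCt (ENNReal.inv_ne_top.2 ?_)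
    rw [Ne, tsub_eq_zero_iff_le, not_le, ← ENNReal.ofReal_one,
      ENNReal.ofReal_lt_ofReal_iff one_pos]
    exact hq1
  filter_upwards [ae_lt_top (Measurable.tsum hmeas) hint] with a ha
  have hc := continuous_coding_right hn a
  have : IsProbabilityMeasure (μ.map (coding T a)) :=
    Measure.isProbabilityMeasure_map hc.measurable.aemeasurable
  refine le_dimH_of_tsum_lintegral_closedBall_ne_top
    (isCompact_range hc).isClosed.measurableSet (map_coding_compl_range hn a μ) hs ?_
  simp only [lintegral_map_closedBall hn a μ]
  exact ha.ne

theorem ae_dimH_range_coding_eq (hd : 1 ≤ d) (hM : 2 ≤ M) (hT : ∀ j, (T j).det ≠ 0)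
    (hn : ∀ j, ‖T j‖ < 1 / 2) (hsd : sA T ≤ d) :
    ∀ᵐ a : Fin M → E d, dimH (range (coding T a)) = ENNReal.ofReal (sA T) := by
  -- A countable sequence of exponents increasing to `s_A` leaves a single null set of exceptional
  -- `a`.
  obtain ⟨u, -, hu, hlim⟩ := exists_seq_strictMono_tendsto' (sA_pos hd hM hT hn)
  have h1 : ∀ᵐ a : Fin M → E d, ∀ n, ENNReal.ofReal (u n) ≤ dimH (range (coding T a)) :=
    ae_all_iff.2 fun n => ae_le_dimH_range_coding hd (by omega) hT hn hsd (hu n).1 (hu n).2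
  filter_upwards [h1] with a ha
  exact (dimH_range_coding_le hd hM hT hn hsd a).antisymm
    (le_of_tendsto' (ENNReal.tendsto_ofReal hlim) ha)

/-- Transversality is used at exponent exactly `d`, so the scales give no geometric gain. The
normalised averages are only bounded, and Fatou's lemma turns this into a finite lower limit for
almost every `a`. -/
theorem ae_volume_range_coding_pos (hd : 1 ≤ d) (hM : 1 ≤ M) (hT : ∀ j, (T j).det ≠ 0)
    (hn : ∀ j, ‖T j‖ < 1 / 2) (hsd : (d : ℝ) < sA T) :
    ∀ᵐ a : Fin M → E d, 0 < volume (range (coding T a)) := by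
  obtain ⟨s, hs1, hs2⟩ := exists_between hsd
  have hd0 : (0 : ℝ) ≤ d := Nat.cast_nonneg d
  obtain ⟨μ, hμp, K, hK, hμ⟩ := exists_frostman_measure hd hM hT hn (hd0.trans hs1.le) hs2
  refine ae_of_forall_closedBall fun ρ hρ => ?_
  obtain ⟨C, hCt, hC⟩ := exists_setLIntegral_closePairs_le hd hM hT hn hd0 le_rfl hs1 hρ hK hμ
  have hmeas : ∀ n : ℕ, Measurable fun a : Fin M → E d =>
      (ENNReal.ofReal (((1 / 2 : ℝ) ^ n) ^ (d : ℝ)))⁻¹ *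
        μ.prod μ (closePairs T a ((1 / 2 : ℝ) ^ n)) := fun n =>
    (measurable_measure_closePairs hn _ _).const_mul _
  have hint : ∫⁻ a in Metric.closedBall (0 : Fin M → E d) ρ, liminf (fun n : ℕ =>
      (ENNReal.ofReal (((1 / 2 : ℝ) ^ n) ^ (d : ℝ)))⁻¹ *
        μ.prod μ (closePairs T a ((1 / 2 : ℝ) ^ n))) atTop ≠ ∞ := by
    refine ne_top_of_le_ne_top hCt ((lintegral_liminf_le hmeas).trans ?_)
    refine liminf_le_of_frequently_le' (Frequently.of_forall fun n => ?_)
    rw [lintegral_const_mul _ (measurable_measure_closePairs hn _ _), mul_comm, ← div_eq_mul_inv]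
    exact ENNReal.div_le_of_le_mul (hC _ (by positivity))
  filter_upwards [ae_lt_top (Measurable.liminf hmeas) hint] with a ha
  have hc := continuous_coding_right hn a
  have : IsProbabilityMeasure (μ.map (coding T a)) :=
    Measure.isProbabilityMeasure_map hc.measurable.aemeasurable
  refine volume_pos_of_liminf_lintegral_closedBall_lt_top (isCompact_range hc)
    (map_coding_compl_range hn a μ) ?_
  simp only [lintegral_map_closedBall hn a μ]
  exact ha

end Energy

end SelfAffine

/-! ### The theorem -/

theorem mainTheorem11 (d M : ℕ) (hd : 1 ≤ d) (hM : 2 ≤ M)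
    (T : Fin M → (SelfAffine.E d →L[ℝ] SelfAffine.E d))
    (hT_nonsing : ∀ j, (T j).det ≠ 0) (hT_norm : ∀ j, ‖T j‖ < 1 / 2) :
    -- the critical value `s_A` is well defined, from either side
    IsGLB {s : ℝ | 0 ≤ s ∧ SelfAffine.netMeasure T s univ = 0} (SelfAffine.sA T) ∧
    IsLUB {s : ℝ | 0 ≤ s ∧ SelfAffine.netMeasure T s univ = ∞} (SelfAffine.sA T) ∧
    -- it is the affinity dimension
    (∀ s : ℝ, SelfAffine.IsAffinityDim T s ↔ s = SelfAffine.sA T) ∧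
    -- every translation vector determines a self-affine set
    (∀ a : Fin M → SelfAffine.E d, ∃! F : Set (SelfAffine.E d), SelfAffine.IsAttractor T a F) ∧
    -- and for almost every translation vector its size is given by `s_A`
    ∀ᵐ a : Fin M → SelfAffine.E d, ∀ F : Set (SelfAffine.E d), SelfAffine.IsAttractor T a F →
      (SelfAffine.sA T ≤ d → dimH F = ENNReal.ofReal (SelfAffine.sA T)) ∧
      ((d : ℝ) < SelfAffine.sA T → 0 < (volume : Measure (SelfAffine.E d)) F) := by
  have hM1 : 1 ≤ M := by omega
  refine ⟨SelfAffine.isGLB_sA hd hM1 hT_nonsing hT_norm,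
    SelfAffine.isLUB_sA hd hM hT_nonsing hT_norm,
    SelfAffine.isAffinityDim_iff hd hM hT_nonsing hT_norm,
    fun a => ⟨_, SelfAffine.isAttractor_range_coding hM1 hT_norm a,
      fun F hF => hF.eq_range_coding hM1 hT_norm⟩, ?_⟩
  rcases le_or_gt (SelfAffine.sA T) d with h | h
  · filter_upwards [SelfAffine.ae_dimH_range_coding_eq hd hM hT_nonsing hT_norm h] with a ha F hF
    rw [hF.eq_range_coding hM1 hT_norm]
    exact ⟨fun _ => ha, fun h' => absurd h h'.not_ge⟩
  · filter_upwards [SelfAffine.ae_volume_range_coding_pos hd hM1 hT_nonsing hT_norm h]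
      with a ha F hF
    rw [hF.eq_range_coding hM1 hT_norm]
    exact ⟨fun h' => absurd h' h.not_ge, fun _ => ha⟩
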